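/- Let $\mathcal{H}_d$ be the real vector space of hermitian complex $d\times d$ matrices with the Hilbert-Schmidt norm, and let $\mathcal{T}_d$ be the set of real-linear maps $T:\mathcal{H}_d\to\mathcal{H}_d$ with $T(\mathbb{1})=\mathbb{1}$. Expressing $T\in\mathcal{T}_d$ as a real $d^2\times d^2$ matrix in a basis of $\mathcal{H}_d$ whose first element is $\mathbb{1}$, the first column is $(1,0,\dots,0)$, so that $\mathcal{T}_d$ is identified with $\mathbb{R}^{d^2\times(d^2-1)}$; "null set" and "non-zero measure" in $\mathcal{T}_d$ refer to Lebesgue (outer) measure in these coordinates, for any such basis. Let $\mathcal{C}_d\subset\mathcal{T}_d$ be the set of quantum channels in the Heisenberg picture, i.e. of completely positive maps, let $\mathcal{G}_d$ be the set of linear maps $L:\mathcal{H}_d\to\mathcal{H}_d$ with $e^{tL}\in\mathcal{C}_d$ for all $t\ge 0$, and let $\mathcal{L}_d=\{T\in\mathcal{T}_d\mid \exists L\in\mathcal{G}_d:\ T=e^L\}$. For a bounded set $A$ let $N(\epsilon,A)$ be the least number of open $\epsilon$-balls with centres in $A$ that cover $A$, and let $D(A)=\limsup_{\epsilon\to 0}\frac{\ln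 N(\epsilon,A)}{\ln(1/\epsilon)}$ be its Minkowski dimension (with $D(\emptyset)=0$). **Theorem.** Let $S\subset\mathcal{H}_d$ be a closed set of density operators, let $H_0\in\mathcal{H}_d$ not be a multiple of the identity, let $m\in\mathbb{N}$ with $m>D(S-S)$, where $S-S=\{x-y\mid x,y\in S\}$, and let $\theta\in\big(0,\,1-D(S-S)/m\big)$. Consider, for $T\in\mathcal{T}_d$, the map $$S\ni\rho\ \mapsto\ \big(\mathrm{tr}[\rho\,T^i(H_0)]\big)_{i=1}^m\in\mathbb{R}^m .$$ The set of channels $T\in\mathcal{C}_d$ for which this map is injective on $S$ with a $\theta$-Hölder continuous inverse has non-zero measure in $\mathcal{T}_d$, and its complement in $\mathcal{C}_d$ is a null set. The same is true with $\mathcal{C}_d$ replaced by $\mathcal{L}_d$. Here $\theta$-Hölder continuity of a function $f$ means that there is a constant $c$ with $\|f(x)-f(y)\|\le c\,\|x-y\|^\theta$ for all $x,y$ in its domain. -/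

import Mathlib

open scoped Matrix.Norms.Frobenius ComplexOrder ComplexStarModule Pointwise Topology

noncomputable section

namespace QTomo

/-- The real vector space of hermitian complex `d × d` matrices. -/
def Herm (d : ℕ) : Type := selfAdjoint (Matrix (Fin d) (Fin d) ℂ)

/-- The norm is the Hilbert-Schmidt (Frobenius) norm; the topology is the one it induces. -/
instance (d : ℕ) : NormedAddCommGroup (Herm d) :=
  inferInstanceAs (NormedAddCommGroup (selfAdjoint (Matrix (Fin d) (Fin d) ℂ)))

instance (d : ℕ) : NormedSpace ℝ (Herm d) :=
  inferInstanceAs (NormedSpace ℝ (selfAdjoint (Matrix (Fin d) (Fin d) ℂ)))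

/-- The identity matrix. -/
instance (d : ℕ) : One (Herm d) :=
  inferInstanceAs (One (selfAdjoint (Matrix (Fin d) (Fin d) ℂ)))

/-- The underlying matrix of an element of `Herm d`. -/
def Herm.mat {d : ℕ} (X : Herm d) : Matrix (Fin d) (Fin d) ℂ := X.1

/-- The (automatically continuous) real-linear maps on hermitian matrices, with composition as
product. -/
abbrev HermMap (d : ℕ) : Type := Herm d →L[ℝ] Herm d

/-- Density operators: positive semidefinite matrices of trace one. -/
def densityOperators (d : ℕ) : Set (Herm d) :=
  {ρ | ρ.mat.PosSemidef ∧ ρ.mat.trace = 1}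

/-- The expectation value `tr[ρ H]`; the trace of a product of two hermitian matrices is real. -/
def expectation {d : ℕ} (ρ H : Herm d) : ℝ := (ρ.mat * H.mat).trace.re

/-- The hermiticity preserving unital linear maps. -/
def unitalMaps (d : ℕ) : Set (HermMap d) := {T | T 1 = 1}

/-- The hermitian matrix `(X + Xᴴ) / 2`. -/
def rePart {d : ℕ} (X : Matrix (Fin d) (Fin d) ℂ) : Herm d := ℜ X

/-- The hermitian matrix `(X - Xᴴ) / (2i)`. -/
def imPart {d : ℕ} (X : Matrix (Fin d) (Fin d) ℂ) : Herm d := ℑ X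

/-- The complex-linear extension of `T` to all matrices. -/
def complexify {d : ℕ} (T : HermMap d) (X : Matrix (Fin d) (Fin d) ℂ) :
    Matrix (Fin d) (Fin d) ℂ :=
  (T (rePart X)).mat + Complex.I • (T (imPart X)).mat

/-- Complete positivity: for every `n`, applying the complex-linear extension of `T` to each block
of a positive semidefinite `n × n` block matrix gives a positive semidefinite matrix. -/
def IsCompletelyPositive {d : ℕ} (T : HermMap d) : Prop :=
  ∀ (n : ℕ) (M : Matrix (Fin n) (Fin n) (Matrix (Fin d) (Fin d) ℂ)),
    (Matrix.comp (Fin n) (Fin n) (Fin d) (Fin d) ℂ M).PosSemidef →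
      (Matrix.comp (Fin n) (Fin n) (Fin d) (Fin d) ℂ (M.map (complexify T))).PosSemidef

/-- Quantum channels in the Heisenberg picture: unital completely positive maps. -/
def channels (d : ℕ) : Set (HermMap d) :=
  {T | T ∈ unitalMaps d ∧ IsCompletelyPositive T}

/-- Lindblad generators: generators of one-parameter semigroups of quantum channels. -/
def lindbladGenerators (d : ℕ) : Set (HermMap d) :=
  {L | ∀ t : ℝ, 0 ≤ t → NormedSpace.exp (t • L) ∈ channels d}

/-- Elements of quantum dynamical (Lindblad) semigroups. -/
def lindbladMaps (d : ℕ) : Set (HermMap d) :=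
  {T | T ∈ unitalMaps d ∧ ∃ L ∈ lindbladGenerators d, T = NormedSpace.exp L}

/-- The coordinates of a map in a basis `b`: the entries of its matrix in the columns other
than the first one (column `j` lists the coordinates of the image of the `j`-th basis element).
If `b 0 = 1`, this is a bijection from the unital maps to the real
`(k + 1) × k` matrices, because the first column is then `(1, 0, …, 0)`. -/
def coords {d k : ℕ} (b : Module.Basis (Fin (k + 1)) ℝ (Herm d)) (T : HermMap d) :
    Fin (k + 1) → Fin k → ℝ :=
  fun i j => b.repr (T (b j.succ)) i

/-- The Lebesgue (outer) measure, in the coordinates given by `b`, of a set of unital maps. -/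
def unitalVolume {d k : ℕ} (b : Module.Basis (Fin (k + 1)) ℝ (Herm d)) (A : Set (HermMap d)) :
    ENNReal :=
  MeasureTheory.volume (coords b '' A)

/-- The least number of open `ε`-balls with centres in `S` that cover `S`. -/
def coveringNumber {E : Type*} [PseudoMetricSpace E] (ε : ℝ) (S : Set E) : ℕ :=
  sInf {n : ℕ | ∃ x : Fin n → E, (∀ i, x i ∈ S) ∧ S ⊆ ⋃ i, Metric.ball (x i) ε}

/-- The Minkowski (upper box counting) dimension of a bounded set. -/
def minkowskiDim {E : Type*} [PseudoMetricSpace E] (S : Set E) : EReal :=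
  Filter.limsup
    (fun ε : ℝ => ((Real.log (coveringNumber ε S) / Real.log (1 / ε) : ℝ) : EReal))
    (𝓝[>] (0 : ℝ))

/-- The time series `(tr[ρ T^i(H₀)])` for `i = 1, …, m`. -/
def timeSeries {d : ℕ} (m : ℕ) (H₀ : Herm d) (T : HermMap d) (ρ : Herm d) :
    EuclideanSpace ℝ (Fin m) :=
  WithLp.toLp 2 fun i => expectation ρ ((T ^ (i.val + 1)) H₀)

/-- `f` is injective on `S` and its inverse `f '' S → S` is `θ`-Hölder continuous. -/
def InjWithHolderInverse {E F : Type*} [NormedAddCommGroup E] [NormedAddCommGroup F]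
    (θ : ℝ) (f : E → F) (S : Set E) : Prop :=
  Set.InjOn f S ∧ ∃ g : F → E, Set.LeftInvOn g f S ∧
    ∃ c : ℝ, ∀ x ∈ f '' S, ∀ y ∈ f '' S, ‖g x - g y‖ ≤ c * ‖x - y‖ ^ θ

/-- The maps `T` for which the time series determines the states in `S`, with `θ`-Hölder
continuous inverse. -/
def goodMaps {d : ℕ} (m : ℕ) (H₀ : Herm d) (S : Set (Herm d)) (θ : ℝ) : Set (HermMap d) :=
  {T | InjWithHolderInverse θ (timeSeries m H₀ T) S}

end QTomo

end

noncomputable section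

namespace QTomo

open MeasureTheory Measure Set Filter

/-! A unital `T` acts on hermitian matrices modulo multiples of `1` through a `k × k` block `A`.
Differences `x` of states are traceless, so `tr[x T^i(H₀)]` is a dot product `ξ x ⬝ᵥ A ^ i h`, where
`h ≠ 0` represents `H₀` modulo `1`. The time series thus tests `x` against the orbit `A h, A² h, …`.

If the orbit is replaced by an arbitrary tuple `W`, the claim is a projection theorem
(`ae_holder_bound`). At scale `ε`, about `ε ^ (-α)` balls cover `S - S`, and a centre of norm at
least about `ε ^ θ` has all of its first `m` products with `W` of size `O(ε)` only for `W` in a set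
of volume `O(ε ^ (m (1 - θ)))`. For `D(S - S) < α < m (1 - θ)` the dyadic sum converges, and
Borel-Cantelli applies. When `m > k`, invertibility of `W` is enough.

Null sets of tuples pull back to null sets of matrices (`ae_orbit`): where `h, A h, …, A ^ (k - 1)
h` is a basis, `A` is a differentiable function of its orbit, and elsewhere a nonzero polynomial in
`A` vanishes. So almost every unital map is good.

Finally, Lindblad maps, hence channels, have positive measure (`unitalVolume_lindbladMaps_ne_zero`).
All maps near the depolarizing channel are completely positive, so the `t (Ψ - 1)` with `Ψ` a unital
map near it form an open set of generators, and `exp` is a local diffeomorphism at `0`. -/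

/-! ### Null sets detected on lines. -/

/-- A closed set that meets every ray from `x₀` in a countable set is null. -/
theorem measure_eq_zero_of_countable_on_rays {E : Type*} [NormedAddCommGroup E] [NormedSpace ℝ E]
    [FiniteDimensional ℝ E] [MeasurableSpace E] [BorelSpace E] (μ : Measure E) [μ.IsAddHaarMeasure]
    {Z : Set E} (hZ : IsClosed Z) {x₀ : E} (hx₀ : x₀ ∉ Z)
    (h : ∀ u : E, {t : ℝ | x₀ + t • u ∈ Z}.Countable) : μ Z = 0 := by
  set Y : Set E := (fun x => x₀ + x) ⁻¹' Z with hYdef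
  have hY : IsClosed Y := hZ.preimage (by fun_prop)
  have hμ : μ Z = μ Y := (measure_preimage_add μ x₀ Z).symm
  rw [hμ]
  have h0 : (0 : E) ∉ Y := by simpa [hYdef] using hx₀
  -- Polar coordinates: each radial slice is countable, hence null, and Fubini applies.
  have hpre := μ.measurePreserving_homeomorphUnitSphereProd
  set Y' : Set ({0}ᶜ : Set E) := Subtype.val ⁻¹' Y
  have hY' : MeasurableSet Y' := hY.measurableSet.preimage measurable_subtype_coe
  have e1 : μ Y = (μ.comap (Subtype.val : ({0}ᶜ : Set E) → E)) Y' := by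
    rw [comap_apply _ Subtype.val_injective (fun s hs =>
      (measurableSet_singleton (0 : E)).compl.subtype_image hs) _ hY']
    congr 1
    rw [Subtype.image_preimage_coe]
    ext x
    simp only [mem_inter_iff, mem_compl_iff, mem_singleton_iff]
    exact ⟨fun hx => ⟨fun h => h0 (h ▸ hx), hx⟩, fun hx => hx.2⟩
  have e2 : Y' = homeomorphUnitSphereProd E ⁻¹' ((homeomorphUnitSphereProd E).symm ⁻¹' Y') := by
    ext x; simp
  have hm : MeasurableSet ((homeomorphUnitSphereProd E).symm ⁻¹' Y') :=
    hY'.preimage (homeomorphUnitSphereProd E).symm.measurable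
  rw [e1, e2, hpre.measure_preimage hm.nullMeasurableSet, measure_prod_null hm]
  filter_upwards with u
  rw [Pi.zero_apply, volumeIoiPow]
  apply withDensity_absolutelyContinuous
  rw [comap_apply _ Subtype.val_injective (fun s hs => measurableSet_Ioi.subtype_image hs) _
    (hm.preimage (by fun_prop))]
  refine measure_mono_null ?_ ((h u.1).measure_zero volume)
  rintro _ ⟨r, hr, rfl⟩
  simpa [Y', hYdef] using hr

/-- The zero set of a continuous function that is polynomial on lines through a point at which it
does not vanish is null. -/
theorem measure_zeros_eq_zero_of_polynomial_on_lines {E : Type*} [NormedAddCommGroup E]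
    [NormedSpace ℝ E] [FiniteDimensional ℝ E] [MeasurableSpace E] [BorelSpace E] (μ : Measure E)
    [μ.IsAddHaarMeasure] {f : E → ℝ} (hf : Continuous f) {x₀ : E} (hx₀ : f x₀ ≠ 0)
    (h : ∀ u : E, ∃ p : Polynomial ℝ, ∀ t : ℝ, f (x₀ + t • u) = p.eval t) :
    μ {x | f x = 0} = 0 := by
  refine measure_eq_zero_of_countable_on_rays μ (isClosed_eq hf continuous_const) hx₀ fun u => ?_
  obtain ⟨p, hp⟩ := h u
  have hp0 : p ≠ 0 := by
    rintro rfl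
    exact hx₀ (by simpa using hp 0)
  refine (p.roots.toFinset.countable_toSet).mono fun t ht => ?_
  have : p.eval t = 0 := by rw [← hp]; exact ht
  simpa [hp0] using this

/-! ### Slab volumes and the almost sure Hölder bound for arbitrary tuples. -/

/-- The slab `|⟨w, z⟩| ≤ δ` in the cube of radius `R` has volume `O(δ / ‖z‖)`. -/
theorem volume_slab_le {k : ℕ} (z : Fin k → ℝ) (hz : z ≠ 0) (R δ : ℝ) (hR : 0 ≤ R) (hδ : 0 ≤ δ) :
    volume {w : Fin k → ℝ | (∀ j, |w j| ≤ R) ∧ |z ⬝ᵥ w| ≤ δ} ≤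
      ENNReal.ofReal ((2 * R) ^ (k - 1) * (2 * (δ / ‖z‖))) := by
  classical
  obtain ⟨p, hp⟩ : ∃ p, ‖z‖ = |z p| := by
    have hk : Nonempty (Fin k) := by
      by_contra hne
      rw [not_nonempty_iff] at hne
      exact hz (Subsingleton.elim _ _)
    obtain ⟨p, hp⟩ := Finite.exists_max fun j => ‖z j‖
    exact ⟨p, le_antisymm ((pi_norm_le_iff_of_nonneg (norm_nonneg _)).2 hp) (norm_le_pi_norm z p)⟩
  have hzp : z p ≠ 0 := by
    intro h
    rw [h, abs_zero, norm_eq_zero] at hp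
    exact hz hp
  -- `M` keeps all coordinates except the `p`-th, which becomes the dot product with `z`. It sends
  -- the slab into a box, and its determinant `z p` has modulus `‖z‖` by the choice of `p`.
  set M : Matrix (Fin k) (Fin k) ℝ := (1 : Matrix (Fin k) (Fin k) ℝ).updateRow p z with hM
  have hdet : M.det = z p := by
    rw [hM, ← Matrix.cramer_transpose_apply, Matrix.transpose_one, Matrix.cramer_one]
    rfl
  have hsub : {w : Fin k → ℝ | (∀ j, |w j| ≤ R) ∧ |z ⬝ᵥ w| ≤ δ} ⊆
      Matrix.toLin' M ⁻¹' (Set.pi univ fun j => if j = p then Icc (-δ) δ else Icc (-R) R) := by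
    rintro w ⟨h1, h2⟩
    simp only [mem_preimage, Set.mem_pi, mem_univ, true_imp_iff, Matrix.toLin'_apply]
    intro j
    split_ifs with hj
    · subst hj
      rw [hM]
      simpa [Matrix.mulVec, ← abs_le] using h2
    · rw [hM]
      simpa [Matrix.mulVec, Matrix.updateRow_ne hj, ← abs_le, Matrix.one_apply, dotProduct]
        using h1 j
  refine (measure_mono hsub).trans ?_
  have hdet' : LinearMap.det (Matrix.toLin' M) ≠ 0 := by
    rw [LinearMap.det_toLin', hdet]; exact hzp
  rw [addHaar_preimage_linearMap _ hdet', LinearMap.det_toLin', hdet, volume_pi_pi]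
  have hprod : ∏ j : Fin k, volume (if j = p then Icc (-δ) δ else Icc (-R) R) =
      ENNReal.ofReal ((2 * R) ^ (k - 1) * (2 * δ)) := by
    rw [← Finset.mul_prod_erase _ _ (Finset.mem_univ p)]
    rw [Finset.prod_congr rfl (g := fun _ => ENNReal.ofReal (2 * R))]
    · simp only [if_true, Real.volume_Icc, Finset.prod_const, Finset.card_erase_of_mem
        (Finset.mem_univ p), Finset.card_univ, Fintype.card_fin]
      rw [← ENNReal.ofReal_pow (by positivity), ← ENNReal.ofReal_mul (by linarith)]
      congr 1; ring
    · intro j hj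
      rw [if_neg (Finset.ne_of_mem_erase hj), Real.volume_Icc]
      congr 1; ring
  rw [hprod, ← ENNReal.ofReal_mul (by positivity), hp, abs_inv]
  apply le_of_eq
  congr 1
  rw [div_eq_mul_inv]; ring

/-- The rows of `W` are independent coordinates, so the volumes multiply: one slab for each of the
first `m` rows, a full cube for each other row. -/
theorem exists_volume_slabs_le {k m : ℕ} (hmk : m ≤ k) (R : ℝ) (hR : 0 ≤ R) :
    ∃ C : ℝ, 0 ≤ C ∧ ∀ (z : Fin k → ℝ) (δ : ℝ), z ≠ 0 → 0 ≤ δ →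
      volume {W : Fin k → Fin k → ℝ | (∀ l j, |W l j| ≤ R) ∧
        ∀ l : Fin k, l.val < m → |z ⬝ᵥ W l| ≤ δ} ≤ ENNReal.ofReal (C * (δ / ‖z‖) ^ m) := by
  refine ⟨(2 * (2 * R) ^ (k - 1)) ^ m * ((2 * R) ^ k) ^ (k - m), by positivity,
    fun z δ hz hδ => ?_⟩
  have hsub : {W : Fin k → Fin k → ℝ | (∀ l j, |W l j| ≤ R) ∧
        ∀ l : Fin k, l.val < m → |z ⬝ᵥ W l| ≤ δ} ⊆
      Set.pi univ fun l : Fin k => if l.val < m then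
        {w : Fin k → ℝ | (∀ j, |w j| ≤ R) ∧ |z ⬝ᵥ w| ≤ δ}
        else Set.pi univ fun _ => Icc (-R) R := by
    rintro W ⟨h1, h2⟩ l -
    dsimp only
    split_ifs with hl
    · exact ⟨h1 l, h2 l hl⟩
    · exact fun j _ => abs_le.1 (h1 l j)
  refine (measure_mono hsub).trans ?_
  rw [volume_pi_pi]
  have hle : ∀ l ∈ (Finset.univ : Finset (Fin k)),
      volume (if l.val < m then {w : Fin k → ℝ | (∀ j, |w j| ≤ R) ∧ |z ⬝ᵥ w| ≤ δ}
        else Set.pi univ fun _ => Icc (-R) R) ≤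
      if l.val < m then ENNReal.ofReal ((2 * R) ^ (k - 1) * (2 * (δ / ‖z‖)))
        else ENNReal.ofReal ((2 * R) ^ k) := by
    intro l _
    split_ifs with hl
    · exact volume_slab_le z hz R δ hR hδ
    · rw [volume_pi_pi]
      simp only [Real.volume_Icc, Finset.prod_const, Finset.card_univ, Fintype.card_fin]
      rw [← ENNReal.ofReal_pow (by linarith)]
      apply le_of_eq; congr 2; ring
  refine (Finset.prod_le_prod' hle).trans ?_
  rw [Finset.prod_ite, Finset.prod_const, Finset.prod_const]
  have hc : (Finset.univ.filter fun l : Fin k => l.val < m).card = m := by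
    rw [Fin.card_filter_val_lt, min_eq_right hmk]
  have hc' : (Finset.univ.filter fun l : Fin k => ¬ l.val < m).card = k - m := by
    rw [Finset.filter_not, Finset.card_sdiff_of_subset (Finset.filter_subset _ _), hc]
    simp
  rw [hc, hc', ← ENNReal.ofReal_pow (by positivity), ← ENNReal.ofReal_pow (by positivity),
    ← ENNReal.ofReal_mul (by positivity)]
  apply le_of_eq
  congr 1
  rw [mul_pow, mul_pow, mul_pow]; ring

theorem abs_dotProduct_le {k : ℕ} (z w : Fin k → ℝ) {R : ℝ} (hw : ∀ j, |w j| ≤ R) :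
    |z ⬝ᵥ w| ≤ k * ‖z‖ * R := by
  calc |z ⬝ᵥ w| ≤ ∑ j, |z j * w j| := Finset.abs_sum_le_sum_abs _ _
    _ ≤ ∑ _j : Fin k, ‖z‖ * R := Finset.sum_le_sum fun j _ => by
        rw [abs_mul]
        exact mul_le_mul (norm_le_pi_norm z j) (hw j) (abs_nonneg _) (norm_nonneg _)
    _ = k * ‖z‖ * R := by simp [mul_assoc]

/-- A bound at all small dyadic scales gives a Hölder bound. -/
theorem exists_holder_bound_of_dyadic {E : Type*} [NormedAddCommGroup E] {X : Set E} {B θ : ℝ}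
    (hθ : 0 < θ) (hB : ∀ x ∈ X, ‖x‖ ≤ B) (P : E → ℝ → Prop)
    (hmono : ∀ x q q', q ≤ q' → P x q → P x q') (J : ℕ)
    (h : ∀ j, J ≤ j → ∀ x ∈ X, P x ((1 / 2 : ℝ) ^ j) → ‖x‖ ≤ ((1 / 2 : ℝ) ^ j) ^ θ) :
    ∃ C : ℝ, ∀ x ∈ X, ∀ q, 0 ≤ q → P x q → ‖x‖ ≤ C * q ^ θ := by
  -- The term `2 ^ θ` pays for rounding `q` up to a power of `1 / 2`; the other term covers `q > (1
  -- / 2) ^ J`, where only `‖x‖ ≤ B` is available.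
  refine ⟨2 ^ θ + |B| * ((2 : ℝ) ^ J) ^ θ, fun x hx q hq hP => ?_⟩
  rcases hq.eq_or_lt with rfl | hq0
  · rw [Real.zero_rpow hθ.ne', mul_zero]
    have hlim : Tendsto (fun j : ℕ => ((1 / 2 : ℝ) ^ j) ^ θ) atTop (𝓝 0) := by
      have := (tendsto_pow_atTop_nhds_zero_of_lt_one (r := (1 / 2 : ℝ)) (by norm_num)
        (by norm_num)).rpow_const (p := θ) (Or.inr hθ.le)
      rwa [Real.zero_rpow hθ.ne'] at this
    refine ge_of_tendsto hlim ?_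
    filter_upwards [eventually_ge_atTop J] with j hj
    exact h j hj x hx (hmono _ _ _ (by positivity) hP)
  have hqθ : 0 ≤ q ^ θ := Real.rpow_nonneg hq _
  rcases le_or_gt q ((1 / 2 : ℝ) ^ J) with hqJ | hqJ
  · obtain ⟨n, hn1, hn2⟩ := exists_nat_pow_near_of_lt_one hq0
      (hqJ.trans (pow_le_one₀ (by norm_num) (by norm_num))) (by norm_num : (0 : ℝ) < 1 / 2)
      (by norm_num)
    have hJn : J ≤ n := by
      by_contra hlt
      have := pow_le_pow_of_le_one (by norm_num : (0 : ℝ) ≤ 1 / 2) (by norm_num)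
        (by omega : n + 1 ≤ J)
      linarith
    calc ‖x‖ ≤ ((1 / 2 : ℝ) ^ n) ^ θ := h n hJn x hx (hmono _ _ _ hn2 hP)
      _ ≤ (2 * q) ^ θ := by
        apply Real.rpow_le_rpow (by positivity) _ hθ.le
        rw [pow_succ] at hn1; linarith
      _ = 2 ^ θ * q ^ θ := Real.mul_rpow (by norm_num) hq
      _ ≤ _ := by
        apply mul_le_mul_of_nonneg_right _ hqθ
        have : 0 ≤ |B| * ((2 : ℝ) ^ J) ^ θ := by positivity
        linarith
  · have h1 : 1 ≤ ((2 : ℝ) ^ J) ^ θ * q ^ θ := by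
      rw [← Real.mul_rpow (by positivity) hq]
      apply Real.one_le_rpow _ hθ.le
      calc (1 : ℝ) = 2 ^ J * (1 / 2) ^ J := by rw [← mul_pow]; norm_num
        _ ≤ 2 ^ J * q := by gcongr
    have h2 : 0 ≤ (2 : ℝ) ^ θ * q ^ θ := by positivity
    calc ‖x‖ ≤ |B| * 1 := by rw [mul_one]; exact (hB x hx).trans (le_abs_self B)
      _ ≤ |B| * (((2 : ℝ) ^ J) ^ θ * q ^ θ) := by gcongr
      _ ≤ _ := by rw [add_mul]; nlinarith

/-- Almost every `m`-tuple of functionals separates the points of a set of box dimension less than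
`m`, with a Hölder bound. -/
theorem ae_holder_bound {E : Type*} [NormedAddCommGroup E] [NormedSpace ℝ E] {k m : ℕ}
    (hmk : m ≤ k) {X : Set E} {B θ α c : ℝ}
    (hθ0 : 0 < θ) (hθ1 : θ < 1) (hα : α < m * (1 - θ)) (hB : ∀ x ∈ X, ‖x‖ ≤ B)
    (ξ : E →L[ℝ] (Fin k → ℝ)) (hc : 0 < c) (hξ : ∀ x ∈ X, ‖x‖ ≤ c * ‖ξ x‖)
    (hcov : ∀ᶠ ε : ℝ in 𝓝[>] 0, ∃ n : ℕ, (n : ℝ) ≤ ε ^ (-α) ∧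
      ∃ x : Fin n → E, (∀ i, x i ∈ X) ∧ X ⊆ ⋃ i, Metric.ball (x i) ε) :
    ∀ᵐ W : Fin k → Fin k → ℝ, ∃ C : ℝ, ∀ x ∈ X, ∀ q, 0 ≤ q →
      (∀ l : Fin k, l.val < m → |ξ x ⬝ᵥ W l| ≤ q) → ‖x‖ ≤ C * q ^ θ := by
  -- Restricting to cubes makes the volumes finite; countably many cubes exhaust the space.
  have key : ∀ R : ℕ, ∀ᵐ W : Fin k → Fin k → ℝ, (∀ l j, |W l j| ≤ (R : ℝ)) →
      ∃ C : ℝ, ∀ x ∈ X, ∀ q, 0 ≤ q →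
      (∀ l : Fin k, l.val < m → |ξ x ⬝ᵥ W l| ≤ q) → ‖x‖ ≤ C * q ^ θ := by
    intro R
    obtain ⟨C, hC0, hC⟩ := exists_volume_slabs_le hmk (R : ℝ) (Nat.cast_nonneg R)
    set bad : ℕ → Set (Fin k → Fin k → ℝ) := fun j => {W | (∀ l j, |W l j| ≤ (R : ℝ)) ∧
      ∃ x ∈ X, ((1 / 2 : ℝ) ^ j) ^ θ ≤ ‖x‖ ∧
        ∀ l : Fin k, l.val < m → |ξ x ⬝ᵥ W l| ≤ (1 / 2 : ℝ) ^ j} with hbad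
    -- Moving a point by less than `ε` changes its products with the rows by at most `k * ‖ξ‖ * R *
    -- ε`, so a centre near a bad point has products at most `K * ε`.
    set K : ℝ := 1 + k * ‖ξ‖ * R with hK
    have hK0 : 0 ≤ K := by positivity
    have hlim : Tendsto (fun j : ℕ => (1 / 2 : ℝ) ^ j) atTop (𝓝[>] 0) :=
      tendsto_nhdsWithin_iff.2 ⟨tendsto_pow_atTop_nhds_zero_of_lt_one (by norm_num) (by norm_num),
        Eventually.of_forall fun j => by simp⟩
    have hlim2 : Tendsto (fun j : ℕ => ((1 / 2 : ℝ) ^ j) ^ (1 - θ)) atTop (𝓝 0) := by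
      have := (tendsto_nhds_of_tendsto_nhdsWithin hlim).rpow_const (p := 1 - θ)
        (Or.inr (by linarith))
      rwa [Real.zero_rpow (by linarith)] at this
    have hev : ∀ᶠ j : ℕ in atTop, volume (bad j) ≤
        ENNReal.ofReal (C * (2 * c * K) ^ m * ((1 / 2 : ℝ) ^ (m * (1 - θ) - α)) ^ j) := by
      filter_upwards [hlim.eventually hcov,
        hlim2.eventually (gt_mem_nhds (by norm_num : (0 : ℝ) < 1 / 2))] with j ⟨n, hn, x, hxX, hx⟩ hj
      set ε : ℝ := (1 / 2 : ℝ) ^ j with hε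
      have hε0 : 0 < ε := by positivity
      have hr0 : 0 < ε ^ θ := Real.rpow_pos_of_pos hε0 _
      have hεr : ε = ε ^ (1 - θ) * ε ^ θ := by
        rw [← Real.rpow_add hε0]; simp
      -- This leaves the centre with norm at least `ε ^ θ / 2`.
      have hεr2 : 2 * ε ≤ ε ^ θ := by nlinarith
      set G : Fin n → Set (Fin k → Fin k → ℝ) := fun i => {W | (∀ l j, |W l j| ≤ (R : ℝ)) ∧
        (∀ l : Fin k, l.val < m → |ξ (x i) ⬝ᵥ W l| ≤ K * ε) ∧ ε ^ θ / 2 ≤ ‖x i‖} with hG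
      have hsub : bad j ⊆ ⋃ i, G i := by
        rintro W ⟨hWR, y, hyX, hyn, hy⟩
        obtain ⟨i, hi⟩ := mem_iUnion.1 (hx hyX)
        rw [mem_ball_iff_norm] at hi
        refine mem_iUnion.2 ⟨i, hWR, fun l hl => ?_, ?_⟩
        · have e : ξ (x i) ⬝ᵥ W l = ξ y ⬝ᵥ W l - ξ (y - x i) ⬝ᵥ W l := by
            rw [map_sub, sub_dotProduct]; ring
          rw [e]
          have h1 := abs_dotProduct_le (ξ (y - x i)) (W l) (hWR l)
          have h2 : ‖ξ (y - x i)‖ ≤ ‖ξ‖ * ε := (ξ.le_opNorm _).trans (by gcongr)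
          calc _ ≤ |ξ y ⬝ᵥ W l| + |ξ (y - x i) ⬝ᵥ W l| := abs_sub _ _
            _ ≤ ε + k * (‖ξ‖ * ε) * R := add_le_add (hy l hl) (h1.trans (by gcongr))
            _ = K * ε := by rw [hK]; ring
        · have := norm_sub_norm_le y (x i)
          linarith
      have hGi : ∀ i, volume (G i) ≤ ENNReal.ofReal (C * (2 * c * K * ε ^ (1 - θ)) ^ m) := by
        intro i
        by_cases hi : ε ^ θ / 2 ≤ ‖x i‖
        · have hξi : ε ^ θ / (2 * c) ≤ ‖ξ (x i)‖ := by
            rw [div_le_iff₀ (by positivity)]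
            have := hξ _ (hxX i)
            nlinarith
          have hpos : 0 < ε ^ θ / (2 * c) := by positivity
          have hne : ξ (x i) ≠ 0 := norm_pos_iff.1 (hpos.trans_le hξi)
          have hss : G i ⊆ {W | (∀ l j, |W l j| ≤ (R : ℝ)) ∧
              ∀ l : Fin k, l.val < m → |ξ (x i) ⬝ᵥ W l| ≤ K * ε} := fun W hW => ⟨hW.1, hW.2.1⟩
          refine (measure_mono hss).trans
            ((hC (ξ (x i)) (K * ε) hne (by positivity)).trans ?_)
          apply ENNReal.ofReal_le_ofReal
          apply mul_le_mul_of_nonneg_left _ hC0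
          apply pow_le_pow_left₀ (by positivity)
          calc K * ε / ‖ξ (x i)‖ ≤ K * ε / (ε ^ θ / (2 * c)) := by gcongr
            _ = 2 * c * K * (ε / ε ^ θ) := by field_simp
            _ = 2 * c * K * ε ^ (1 - θ) := by
              congr 1
              rw [div_eq_iff hr0.ne', ← hεr]
        · have : G i = ∅ := by
            ext W; simp [hG, hi]
          rw [this, measure_empty]; exact zero_le
      have hD : 0 ≤ C * (2 * c * K * ε ^ (1 - θ)) ^ m := by positivity
      calc volume (bad j) ≤ ∑ i : Fin n, volume (G i) :=
            (measure_mono hsub).trans (measure_iUnion_fintype_le _ _)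
        _ ≤ ∑ _i : Fin n, ENNReal.ofReal (C * (2 * c * K * ε ^ (1 - θ)) ^ m) :=
            Finset.sum_le_sum fun i _ => hGi i
        _ = ENNReal.ofReal (n * (C * (2 * c * K * ε ^ (1 - θ)) ^ m)) := by
            rw [ENNReal.ofReal_mul (Nat.cast_nonneg n), ENNReal.ofReal_natCast, Finset.sum_const,
              Finset.card_univ, Fintype.card_fin, nsmul_eq_mul]
        _ ≤ ENNReal.ofReal (ε ^ (-α) * (C * (2 * c * K * ε ^ (1 - θ)) ^ m)) := by gcongr
        _ = _ := by
            congr 1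
            have e1 : (ε ^ (1 - θ)) ^ m = ε ^ ((m : ℝ) * (1 - θ)) := by
              rw [← Real.rpow_natCast, ← Real.rpow_mul hε0.le, mul_comm]
            have e2 : ((1 / 2 : ℝ) ^ (m * (1 - θ) - α)) ^ j = ε ^ (m * (1 - θ)) * ε ^ (-α) := by
              rw [← Real.rpow_add hε0, hε, ← Real.rpow_natCast, ← Real.rpow_mul (by norm_num),
                ← Real.rpow_natCast, ← Real.rpow_mul (by norm_num)]
              congr 1; ring
            rw [mul_pow, e1, e2]; ring
    obtain ⟨J, hJ⟩ := eventually_atTop.1 hev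
    -- Borel-Cantelli: the ratio `(1 / 2) ^ (m * (1 - θ) - α)` is below `1`.
    have hsum : ∑' j, volume (bad (j + J)) ≠ ⊤ := by
      refine ne_top_of_le_ne_top ?_ (ENNReal.tsum_le_tsum fun j => hJ (j + J) (by omega))
      apply Summable.tsum_ofReal_ne_top
      apply Summable.mul_left
      apply (summable_nat_add_iff J).2
      apply summable_geometric_of_lt_one (by positivity)
      exact Real.rpow_lt_one (by norm_num) (by norm_num) (by linarith)
    filter_upwards [ae_eventually_notMem hsum] with W hW hWR
    obtain ⟨J', hJ'⟩ := eventually_atTop.1 hW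
    refine exists_holder_bound_of_dyadic hθ0 hB
      (fun x q => ∀ l : Fin k, l.val < m → |ξ x ⬝ᵥ W l| ≤ q)
      (fun x q q' hqq h l hl => (h l hl).trans hqq) (J' + J) fun j hj x hx hP => ?_
    by_contra hcon
    have := hJ' (j - J) (by omega)
    rw [Nat.sub_add_cancel (by omega)] at this
    exact this ⟨hWR, x, hx, (not_le.1 hcon).le, hP⟩
  filter_upwards [ae_all_iff.2 key] with W hW
  obtain ⟨R, hR⟩ := exists_nat_ge ‖W‖
  exact hW R fun l j => ((norm_le_pi_norm (W l) j).trans (norm_le_pi_norm W l)).trans hR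

/-! ### Krylov matrices and the passage from tuples to orbits. -/

/-- The matrix with rows `h, A h, …, A ^ (k - 1) h`. -/
def krylov {R : Type*} [CommRing R] {k : ℕ} (A : Matrix (Fin k) (Fin k) R) (h : Fin k → R) :
    Matrix (Fin k) (Fin k) R :=
  Matrix.of fun l => (A ^ l.val).mulVec h

theorem map_krylov {R R' : Type*} [CommRing R] [CommRing R'] (f : R →+* R') {k : ℕ}
    (A : Matrix (Fin k) (Fin k) R) (h : Fin k → R) :
    f.mapMatrix (krylov A h) = krylov (f.mapMatrix A) (f ∘ h) := by
  ext l j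
  simp only [krylov, RingHom.mapMatrix_apply, Matrix.map_apply, Matrix.of_apply]
  rw [RingHom.map_mulVec, ← RingHom.mapMatrix_apply, ← RingHom.mapMatrix_apply, map_pow]

/-- The nilpotent shift has the first unit vector as a cyclic vector. Conjugating by an isomorphism
`φ` that takes this vector to `h` turns the Krylov matrix into the transpose of `φ`. -/
theorem exists_det_krylov_ne_zero {k : ℕ} {h : Fin k → ℝ} (hh : h ≠ 0) :
    ∃ A : Matrix (Fin k) (Fin k) ℝ, (krylov A h).det ≠ 0 := by
  classical
  have hk : 0 < k := by
    rcases Nat.eq_zero_or_pos k with rfl | hk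
    · exact absurd (Subsingleton.elim _ _) hh
    · exact hk
  set e₀ : Fin k → ℝ := Pi.single ⟨0, hk⟩ 1 with he₀
  have he : e₀ ≠ 0 := by simp [he₀]
  obtain ⟨φ, hφ⟩ := SeparatingDual.exists_continuousLinearEquiv_apply_eq (R := ℝ) he hh
  set N : Matrix (Fin k) (Fin k) ℝ := Matrix.of fun i j => if i.val = j.val + 1 then 1 else 0
    with hN
  set f : (Fin k → ℝ) →ₗ[ℝ] (Fin k → ℝ) :=
    φ.toLinearEquiv.toLinearMap ∘ₗ Matrix.toLin' N ∘ₗ φ.symm.toLinearEquiv.toLinearMap with hf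
  have hpow : ∀ l (hl : l < k), ((LinearMap.toMatrix' f) ^ l).mulVec h =
      φ (Pi.single ⟨l, hl⟩ 1) := by
    intro l
    induction l with
    | zero => intro _; simp [← hφ, he₀]
    | succ l ih =>
      intro hl
      rw [pow_succ', ← Matrix.mulVec_mulVec, ih (by omega), LinearMap.toMatrix'_mulVec]
      simp only [hf, LinearMap.comp_apply, LinearEquiv.coe_coe,
        ContinuousLinearEquiv.coe_toLinearEquiv, ContinuousLinearEquiv.symm_apply_apply,
        Matrix.toLin'_apply]
      congr 1
      ext i
      simp [hN, Pi.single_apply, Fin.ext_iff]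
  refine ⟨LinearMap.toMatrix' f, ?_⟩
  have hK : krylov (LinearMap.toMatrix' f) h =
      (LinearMap.toMatrix' (φ.toLinearEquiv : (Fin k → ℝ) →ₗ[ℝ] (Fin k → ℝ))).transpose := by
    ext l j
    rw [krylov, Matrix.of_apply, hpow l.val l.2]
    simp [LinearMap.toMatrix'_apply]
  rw [hK, Matrix.det_transpose, LinearMap.det_toMatrix']
  exact (LinearEquiv.isUnit_det' φ.toLinearEquiv).ne_zero

theorem volume_det_krylov_eq_zero {k : ℕ} {h : Fin k → ℝ} (hh : h ≠ 0) :
    volume {A : Fin k → Fin k → ℝ | (krylov (Matrix.of A) h).det = 0} = 0 := by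
  obtain ⟨A₀, hA₀⟩ := exists_det_krylov_ne_zero hh
  refine measure_zeros_eq_zero_of_polynomial_on_lines volume ?_
    (x₀ := Matrix.of.symm A₀) hA₀ fun U => ?_
  · apply Continuous.matrix_det
    refine continuous_matrix fun i j => ?_
    have h1 : Continuous fun A : Fin k → Fin k → ℝ => (Matrix.of A : Matrix (Fin k) (Fin k) ℝ) :=
      continuous_id
    exact (continuous_apply j).comp ((h1.pow i.val).matrix_mulVec continuous_const)
  -- Along the line through `A₀`, the same determinant is formed over `ℝ[X]` and then evaluated at
  -- `t`.
  · refine ⟨(krylov (Polynomial.C.mapMatrix A₀ + (Polynomial.X : Polynomial ℝ) •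
      Polynomial.C.mapMatrix (Matrix.of U)) (Polynomial.C ∘ h)).det, fun t => ?_⟩
    rw [← Polynomial.coe_evalRingHom, RingHom.map_det, map_krylov]
    congr 2
    · ext i j
      simp [-Polynomial.X_mul_C]
    · ext i
      simp

theorem volume_det_eq_zero {k : ℕ} :
    volume {W : Fin k → Fin k → ℝ | (Matrix.of W).det = 0} = 0 := by
  refine measure_zeros_eq_zero_of_polynomial_on_lines volume ?_
    (x₀ := Matrix.of.symm (1 : Matrix (Fin k) (Fin k) ℝ)) (by simp) fun U => ?_
  · apply Continuous.matrix_det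
    exact continuous_id
  · refine ⟨((1 : Matrix (Fin k) (Fin k) (Polynomial ℝ)) + (Polynomial.X : Polynomial ℝ) •
      Polynomial.C.mapMatrix (Matrix.of U)).det, fun t => ?_⟩
    rw [← Polynomial.coe_evalRingHom, RingHom.map_det]
    congr 1
    ext i j
    by_cases hij : i = j <;> simp [hij, -Polynomial.X_mul_C]

theorem differentiableAt_det {E : Type*} [NormedAddCommGroup E] [NormedSpace ℝ E] {k : ℕ}
    {M : E → Matrix (Fin k) (Fin k) ℝ} {x : E}
    (hM : ∀ i j, DifferentiableAt ℝ (fun y => M y i j) x) :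
    DifferentiableAt ℝ (fun y => (M y).det) x := by
  simp only [Matrix.det_apply']
  refine DifferentiableAt.fun_sum fun σ _ => DifferentiableAt.const_mul ?_ _
  exact (HasFDerivAt.finsetProd fun i _ => (hM (σ i) i).hasFDerivAt).differentiableAt

theorem differentiableAt_inv_apply {E : Type*} [NormedAddCommGroup E] [NormedSpace ℝ E] {k : ℕ}
    {M : E → Matrix (Fin k) (Fin k) ℝ} {x : E}
    (hM : ∀ i j, DifferentiableAt ℝ (fun y => M y i j) x) (hx : (M x).det ≠ 0) (i j : Fin k) :
    DifferentiableAt ℝ (fun y => (M y)⁻¹ i j) x := by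
  have hd := differentiableAt_det hM
  simp only [Matrix.inv_def, Ring.inverse_eq_inv', Matrix.smul_apply, smul_eq_mul,
    Matrix.adjugate_apply]
  refine (hd.inv hx).mul (differentiableAt_det fun a b => ?_)
  by_cases ha : a = j
  · subst ha; simp
  · simpa [Matrix.updateRow_ne ha] using hM a b

/-- The matrix with rows `h, W 0, …, W (k - 2)`. -/
def shiftRows {k : ℕ} (h : Fin k → ℝ) (W : Fin k → Fin k → ℝ) : Matrix (Fin k) (Fin k) ℝ :=
  Matrix.of fun l => if l.val = 0 then h else W ⟨l.val - 1, by omega⟩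

/-- The matrix `A` with `A h = W 0`, `A (W 0) = W 1`, …. -/
def ofOrbit {k : ℕ} (h : Fin k → ℝ) (W : Fin k → Fin k → ℝ) : Fin k → Fin k → ℝ :=
  Matrix.of.symm (((shiftRows h W)⁻¹ * Matrix.of W).transpose)

/-- Differentiability is all that is needed for null sets to have null images, the dimensions being
equal. -/
theorem differentiableOn_ofOrbit {k : ℕ} (h : Fin k → ℝ) :
    DifferentiableOn ℝ (ofOrbit h) {W | (shiftRows h W).det ≠ 0} := by
  intro W hW
  apply DifferentiableAt.differentiableWithinAt
  refine differentiableAt_pi.2 fun i => differentiableAt_pi.2 fun j => ?_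
  have hap : ∀ a b : Fin k, DifferentiableAt ℝ (fun W : Fin k → Fin k → ℝ => W a b) W := by
    intro a b; fun_prop
  simp only [ofOrbit, Matrix.of_symm_apply, Matrix.transpose_apply, Matrix.mul_apply,
    Matrix.of_apply]
  refine DifferentiableAt.fun_sum fun s _ => DifferentiableAt.mul ?_ (hap s i)
  refine differentiableAt_inv_apply (fun a b => ?_) hW j s
  by_cases ha : a.val = 0
  · simp [shiftRows, ha]
  · simpa [shiftRows, ha] using hap _ b

/-- Images of a vector under the powers `1, …, k` of a matrix. -/
def orbit {k : ℕ} (h : Fin k → ℝ) (A : Fin k → Fin k → ℝ) : Fin k → Fin k → ℝ :=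
  fun l => ((Matrix.of A) ^ (l.val + 1)).mulVec h

theorem shiftRows_orbit {k : ℕ} (h : Fin k → ℝ) (A : Fin k → Fin k → ℝ) :
    shiftRows h (orbit h A) = krylov (Matrix.of A) h := by
  ext l j
  by_cases hl : l.val = 0
  · simp [shiftRows, krylov, hl]
  · simp [shiftRows, krylov, hl, orbit, Nat.sub_add_cancel (Nat.one_le_iff_ne_zero.2 hl)]

theorem ofOrbit_orbit {k : ℕ} (h : Fin k → ℝ) (A : Fin k → Fin k → ℝ)
    (hA : (krylov (Matrix.of A) h).det ≠ 0) : ofOrbit h (orbit h A) = A := by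
  -- Each orbit row is `A` applied to the corresponding Krylov row.
  have h1 : Matrix.of (orbit h A) = krylov (Matrix.of A) h * (Matrix.of A).transpose := by
    ext l j
    simp only [Matrix.of_apply, orbit, krylov, pow_succ', ← Matrix.mulVec_mulVec]
    simp [Matrix.mul_apply, Matrix.mulVec, dotProduct, mul_comm]
  rw [ofOrbit, shiftRows_orbit, h1, Matrix.nonsing_inv_mul_cancel_left _ _ hA.isUnit,
    Matrix.transpose_transpose, Equiv.symm_apply_apply]

/-- If a property holds for almost every `k`-tuple of vectors, it holds for the orbit of a nonzero
vector under almost every matrix. -/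
theorem ae_orbit {k : ℕ} {h : Fin k → ℝ} (hh : h ≠ 0) {p : (Fin k → Fin k → ℝ) → Prop}
    (hp : ∀ᵐ W, p W) : ∀ᵐ A : Fin k → Fin k → ℝ, p (orbit h A) := by
  have h1 : volume (ofOrbit h '' ({W | ¬ p W} ∩ {W | (shiftRows h W).det ≠ 0})) = 0 :=
    addHaar_image_eq_zero_of_differentiableOn_of_addHaar_eq_zero volume
      ((differentiableOn_ofOrbit h).mono inter_subset_right)
      (measure_mono_null inter_subset_left hp)
  refine measure_mono_null (fun A hA => ?_)
    (measure_union_null h1 (volume_det_krylov_eq_zero hh))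
  by_cases hd : (krylov (Matrix.of A) h).det = 0
  · exact Or.inr hd
  · exact Or.inl ⟨orbit h A, ⟨hA, by rw [mem_ofPred, shiftRows_orbit]; exact hd⟩,
      ofOrbit_orbit h A hd⟩

/-! ### The Hilbert-Schmidt pairing and coordinates modulo the identity. -/

theorem Herm.mat_add {d : ℕ} (X Y : Herm d) : (X + Y).mat = X.mat + Y.mat := rfl

theorem Herm.mat_smul {d : ℕ} (a : ℝ) (X : Herm d) : (a • X).mat = a • X.mat := rfl

theorem Herm.mat_one {d : ℕ} : (1 : Herm d).mat = 1 := rfl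

theorem Herm.mat_injective {d : ℕ} : Function.Injective (Herm.mat (d := d)) :=
  Subtype.val_injective

theorem Herm.conjTranspose_mat {d : ℕ} (X : Herm d) : X.mat.conjTranspose = X.mat := X.2

theorem Herm.norm_mat {d : ℕ} (X : Herm d) : ‖X.mat‖ = ‖X‖ := rfl

/-- The pairing `tr[ρ H]` as a bilinear map. -/
def pairing (d : ℕ) : Herm d →ₗ[ℝ] Herm d →ₗ[ℝ] ℝ :=
  LinearMap.mk₂ ℝ expectation
    (fun x y z => by simp [expectation, Herm.mat_add, add_mul])
    (fun a x y => by simp [expectation, Herm.mat_smul])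
    (fun x y z => by simp [expectation, Herm.mat_add, mul_add])
    (fun a x y => by simp [expectation, Herm.mat_smul])

theorem pairing_apply {d : ℕ} (x y : Herm d) : pairing d x y = expectation x y := rfl

theorem eq_zero_of_expectation_self {d : ℕ} {x : Herm d} (hx : expectation x x = 0) : x = 0 := by
  apply Herm.mat_injective
  have h1 : (x.mat.conjTranspose * x.mat).trace = 0 := by
    have h2 := (Matrix.posSemidef_conjTranspose_mul_self x.mat).trace_nonneg
    rw [Complex.nonneg_iff] at h2
    apply Complex.ext
    · rw [Herm.conjTranspose_mat]; exact hx
    · exact h2.2.symm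
  exact Matrix.trace_conjTranspose_mul_self_eq_zero_iff.1 h1

/-- A positive rank-one matrix has norm at most its trace, and the traces of the rank-one summands
add up to `1`. This makes closed sets of states compact. -/
theorem norm_le_one_of_mem_densityOperators {d : ℕ} {ρ : Herm d} (hρ : ρ ∈ densityOperators d) :
    ‖ρ‖ ≤ 1 := by
  obtain ⟨h1, h2⟩ := hρ
  obtain ⟨m, v, hv⟩ := Matrix.posSemidef_iff_eq_sum_vecMulVec.1 h1
  have hn : ∀ i, ‖Matrix.vecMulVec (v i) (star (v i))‖ ≤
      (Matrix.vecMulVec (v i) (star (v i))).trace.re := by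
    intro i
    have e : Matrix.vecMulVec (v i) (star (v i)) =
        Matrix.replicateCol Unit (v i) * (Matrix.replicateCol Unit (v i)).conjTranspose := by
      rw [Matrix.vecMulVec_eq Unit, Matrix.conjTranspose_replicateCol]
    have e2 : ‖WithLp.toLp 2 (v i)‖ ^ 2 = (Matrix.vecMulVec (v i) (star (v i))).trace.re := by
      rw [EuclideanSpace.norm_sq_eq]
      simp [Matrix.trace, Matrix.vecMulVec_apply, Complex.mul_conj, Complex.normSq_eq_norm_sq,
        -Complex.ofReal_pow]
    rw [← e2, e]
    refine (Matrix.frobenius_norm_mul _ _).trans ?_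
    rw [Matrix.frobenius_norm_conjTranspose, Matrix.frobenius_norm_replicateCol, sq]
  rw [← Herm.norm_mat, hv]
  refine (norm_sum_le _ _).trans ((Finset.sum_le_sum fun i _ => hn i).trans ?_)
  rw [← Complex.re_sum, ← Matrix.trace_sum, ← hv, h2, Complex.one_re]

theorem expectation_one_of_mem_densityOperators {d : ℕ} {ρ : Herm d}
    (hρ : ρ ∈ densityOperators d) : expectation ρ 1 = 1 := by
  rw [expectation, Herm.mat_one, mul_one, hρ.2, Complex.one_re]

section Coordinates

variable {d k : ℕ} (b : Module.Basis (Fin (k + 1)) ℝ (Herm d))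

/-- Coordinates of a functional `tr[x ·]`, the first one left out. -/
def dualCoords : Herm d →ₗ[ℝ] (Fin k → ℝ) :=
  LinearMap.pi fun j => (pairing d).flip (b j.succ)

theorem dualCoords_apply (x : Herm d) (j : Fin k) :
    dualCoords b x j = expectation x (b j.succ) := rfl

/-- Coordinates of an operator, the first one left out. -/
def tailCoords (X : Herm d) : Fin k → ℝ := fun i => b.repr X i.succ

/-- The matrix of a map, the first row and the first column left out. -/
def block (T : HermMap d) : Fin k → Fin k → ℝ := fun i => coords b T i.succ

variable {b}

theorem eq_add_sum_tailCoords (hb : b 0 = 1) (X : Herm d) :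
    X = b.repr X 0 • (1 : Herm d) + ∑ j : Fin k, tailCoords b X j • b j.succ := by
  conv_lhs => rw [← b.sum_repr X, Fin.sum_univ_succ, hb]
  rfl

/-- As `T` fixes `1`, it descends to the quotient by `ℝ 1`, where `block b T` is its matrix. -/
theorem tailCoords_apply_unital (hb : b 0 = 1) {T : HermMap d} (hT : T ∈ unitalMaps d)
    (X : Herm d) : tailCoords b (T X) = (Matrix.of (block b T)).mulVec (tailCoords b X) := by
  have hT' : T 1 = 1 := hT
  ext i
  conv_lhs => rw [eq_add_sum_tailCoords hb X]
  have h0 : b.repr 1 i.succ = 0 := by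
    rw [← hb, b.repr_self, Finsupp.single_eq_of_ne (Fin.succ_ne_zero i)]
  simp only [tailCoords, map_add, map_smul, _root_.map_sum, hT', Finsupp.add_apply, Finsupp.smul_apply,
    h0, mul_zero, zero_add, Finsupp.finsetSum_apply, smul_eq_mul, Matrix.mulVec, dotProduct,
    Matrix.of_apply, block, coords]
  exact Finset.sum_congr rfl fun j _ => mul_comm _ _

theorem tailCoords_pow_apply (hb : b 0 = 1) {T : HermMap d} (hT : T ∈ unitalMaps d)
    (X : Herm d) (n : ℕ) :
    tailCoords b ((T ^ n) X) = ((Matrix.of (block b T)) ^ n).mulVec (tailCoords b X) := by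
  induction n with
  | zero => simp
  | succ n ih =>
    rw [pow_succ', pow_succ', ← Matrix.mulVec_mulVec, ← ih, ← tailCoords_apply_unital hb hT]
    rfl

theorem expectation_eq_dotProduct (hb : b 0 = 1) {x : Herm d} (hx : expectation x 1 = 0)
    (Y : Herm d) : expectation x Y = dualCoords b x ⬝ᵥ tailCoords b Y := by
  conv_lhs => rw [eq_add_sum_tailCoords hb Y]
  rw [← pairing_apply] at hx ⊢
  simp only [map_add, map_smul, _root_.map_sum, hx, mul_zero, zero_add, smul_eq_mul, dotProduct,
    dualCoords_apply, pairing_apply]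
  exact Finset.sum_congr rfl fun j _ => mul_comm _ _

theorem tailCoords_ne_zero (hb : b 0 = 1) {H : Herm d}
    (hH : ¬ ∃ a : ℝ, H = a • (1 : Herm d)) : tailCoords b H ≠ 0 := by
  intro h
  apply hH
  refine ⟨b.repr H 0, ?_⟩
  conv_lhs => rw [eq_add_sum_tailCoords hb H]
  simp [h]

/-- A traceless `x` with vanishing dual coordinates pairs to zero with itself. The resulting
injectivity is quantitative in finite dimension. -/
theorem exists_norm_le_dualCoords (hb : b 0 = 1) :
    ∃ c : ℝ, 0 < c ∧ ∀ x : Herm d, expectation x 1 = 0 → ‖x‖ ≤ c * ‖dualCoords b x‖ := by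
  have : FiniteDimensional ℝ (Herm d) := b.finiteDimensional_of_finite
  set F : Herm d →ₗ[ℝ] ℝ × (Fin k → ℝ) := ((pairing d).flip 1).prod (dualCoords b) with hF
  have hker : LinearMap.ker F = ⊥ := by
    rw [LinearMap.ker_eq_bot']
    intro x hx
    have h1 : expectation x 1 = 0 := congrArg Prod.fst hx
    have h2 : dualCoords b x = 0 := congrArg Prod.snd hx
    apply eq_zero_of_expectation_self
    rw [expectation_eq_dotProduct hb h1, h2, zero_dotProduct]
  obtain ⟨K, hK, hKF⟩ := F.exists_antilipschitzWith hker
  refine ⟨K, hK, fun x hx => ?_⟩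
  have h := hKF.le_mul_dist x 0
  rw [map_zero, dist_zero_right, dist_zero_right] at h
  have hFx : F x = (0, dualCoords b x) := Prod.ext hx rfl
  rwa [hFx, Prod.norm_mk, norm_zero, max_eq_right (norm_nonneg _)] at h

/-- Fubini: the row of coefficients along `b 0` is a free factor, so a condition on the block alone
can be tested on the block. -/
theorem volume_image_coords_eq_zero {p : (Fin k → Fin k → ℝ) → Prop} (hp : ∀ᵐ A, p A)
    {B : Set (HermMap d)} (hB : ∀ T ∈ B, ¬ p (block b T)) : unitalVolume b B = 0 := by
  have h1 := volume_preserving_piFinSuccAbove (fun _ : Fin (k + 1) => Fin k → ℝ) 0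
  have h2 : ∀ᵐ M : Fin (k + 1) → Fin k → ℝ, p (fun i => M i.succ) :=
    (Measure.quasiMeasurePreserving_snd.comp h1.quasiMeasurePreserving).ae hp
  refine measure_mono_null ?_ h2
  rintro _ ⟨T, hT, rfl⟩
  exact hB T hT

end Coordinates

/-! ### Box dimension, and almost every unital map is good. -/

theorem exists_cover_of_minkowskiDim_lt {E : Type*} [PseudoMetricSpace E] {X : Set E}
    (hX : IsCompact X) {α : ℝ} (hα : minkowskiDim X < (α : EReal)) :
    ∀ᶠ ε : ℝ in 𝓝[>] 0, ∃ n : ℕ, (n : ℝ) ≤ ε ^ (-α) ∧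
      ∃ x : Fin n → E, (∀ i, x i ∈ X) ∧ X ⊆ ⋃ i, Metric.ball (x i) ε := by
  have h1 := Filter.eventually_lt_of_limsup_lt hα
  have h2 : ∀ᶠ ε : ℝ in 𝓝[>] 0, ε < 1 :=
    (gt_mem_nhds one_pos).filter_mono nhdsWithin_le_nhds
  filter_upwards [h1, h2, self_mem_nhdsWithin] with ε hε hε1 hε0
  have hε0' : (0 : ℝ) < ε := hε0
  -- Compactness rules out the default `sInf ∅ = 0`, so the covering number is attained by an actual
  -- cover.
  have hne : {n : ℕ | ∃ x : Fin n → E, (∀ i, x i ∈ X) ∧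
      X ⊆ ⋃ i, Metric.ball (x i) ε}.Nonempty := by
    obtain ⟨t, htX, htf, ht⟩ := hX.finite_cover_balls hε0'
    refine ⟨htf.toFinset.card, fun i => (htf.toFinset.equivFin.symm i).1, fun i => ?_,
      fun x hx => ?_⟩
    · exact htX (htf.mem_toFinset.1 (htf.toFinset.equivFin.symm i).2)
    · obtain ⟨y, hy, hxy⟩ := mem_iUnion₂.1 (ht hx)
      refine mem_iUnion.2 ⟨htf.toFinset.equivFin ⟨y, htf.mem_toFinset.2 hy⟩, ?_⟩
      simpa using hxy
  refine ⟨coveringNumber ε X, ?_, Nat.sInf_mem hne⟩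
  have hlog : 0 < Real.log (1 / ε) := Real.log_pos (by rw [lt_div_iff₀ hε0']; linarith)
  rw [EReal.coe_lt_coe_iff, div_lt_iff₀ hlog] at hε
  rcases Nat.eq_zero_or_pos (coveringNumber ε X) with h0 | h0
  · rw [h0, Nat.cast_zero]; positivity
  · have hpos : (0 : ℝ) < coveringNumber ε X := by exact_mod_cast h0
    rw [← Real.log_le_log_iff hpos (by positivity), Real.log_rpow hε0']
    rw [one_div, Real.log_inv] at hε
    linarith

/-- This excludes the value `⊥`, so the dimension can be treated as a real number, and it forces `θ
< 1`. -/
theorem minkowskiDim_nonneg {E : Type*} [PseudoMetricSpace E] (X : Set E) :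
    0 ≤ minkowskiDim X := by
  have h2 : ∀ᶠ ε : ℝ in 𝓝[>] 0, ε < 1 :=
    (gt_mem_nhds one_pos).filter_mono nhdsWithin_le_nhds
  refine le_limsup_of_frequently_le (Eventually.frequently ?_)
  filter_upwards [h2, self_mem_nhdsWithin] with ε hε1 hε0
  have hε0' : (0 : ℝ) < ε := hε0
  have hlog : 0 < Real.log (1 / ε) := Real.log_pos (by rw [lt_div_iff₀ hε0']; linarith)
  exact EReal.coe_nonneg.2 (div_nonneg (Real.log_natCast_nonneg _) hlog.le)

/-- Time series of almost every matrix separate points, with a Hölder bound. -/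
theorem ae_holder_bound_orbit {E : Type*} [NormedAddCommGroup E] [NormedSpace ℝ E] {k m : ℕ}
    {X : Set E} {B θ α c : ℝ} {h : Fin k → ℝ} (hh : h ≠ 0)
    (hθ0 : 0 < θ) (hθ1 : θ < 1) (hα : α < m * (1 - θ)) (hB : ∀ x ∈ X, ‖x‖ ≤ B)
    (ξ : E →L[ℝ] (Fin k → ℝ)) (hc : 0 < c) (hξ : ∀ x ∈ X, ‖x‖ ≤ c * ‖ξ x‖)
    (hcov : ∀ᶠ ε : ℝ in 𝓝[>] 0, ∃ n : ℕ, (n : ℝ) ≤ ε ^ (-α) ∧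
      ∃ x : Fin n → E, (∀ i, x i ∈ X) ∧ X ⊆ ⋃ i, Metric.ball (x i) ε) :
    ∀ᵐ A : Fin k → Fin k → ℝ, ∃ C : ℝ, ∀ x ∈ X, ∀ q, 0 ≤ q →
      (∀ i : Fin m, |ξ x ⬝ᵥ ((Matrix.of A) ^ (i.val + 1)).mulVec h| ≤ q) → ‖x‖ ≤ C * q ^ θ := by
  rcases le_or_gt m k with hmk | hmk
  · filter_upwards [ae_orbit hh (ae_holder_bound hmk hθ0 hθ1 hα hB ξ hc hξ hcov)] with A ⟨C, hC⟩
    exact ⟨C, fun x hx q hq hi => hC x hx q hq fun l hl => hi ⟨l.val, hl⟩⟩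
  -- With more than `k` measurements the first `k` already determine `x` linearly: almost every
  -- orbit is a basis, and inverting it gives a Lipschitz bound.
  · have h0 : ∀ᵐ W : Fin k → Fin k → ℝ, (Matrix.of W).det ≠ 0 := by
      rw [ae_iff]
      simpa using volume_det_eq_zero
    filter_upwards [ae_orbit hh h0] with A hA
    set M := Matrix.of (orbit h A) with hM
    set D : ℝ := c * (k * ‖Matrix.of.symm M⁻¹‖) with hD
    have hD0 : 0 ≤ D := by positivity
    -- For `q ≤ 1` the Lipschitz bound suffices, as `q ≤ q ^ θ`; for `q > 1` the bound `B` does.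
    refine ⟨D + |B|, fun x hx q hq hi => ?_⟩
    have h1 : ∀ l, |M.mulVec (ξ x) l| ≤ q := fun l => by
      have := hi ⟨l.val, l.2.trans hmk⟩
      rwa [dotProduct_comm] at this
    have h2 : ‖ξ x‖ ≤ k * ‖Matrix.of.symm M⁻¹‖ * q := by
      refine (pi_norm_le_iff_of_nonneg (by positivity)).2 fun j => ?_
      have e : ξ x = M⁻¹.mulVec (M.mulVec (ξ x)) := by
        rw [Matrix.mulVec_mulVec, Matrix.nonsing_inv_mul _ hA.isUnit, Matrix.one_mulVec]
      rw [e, Real.norm_eq_abs]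
      refine (abs_dotProduct_le (M⁻¹ j) _ h1).trans ?_
      gcongr
      exact norm_le_pi_norm (Matrix.of.symm M⁻¹) j
    have h3 : ‖x‖ ≤ D * q := by
      refine (hξ x hx).trans ?_
      rw [hD, mul_assoc]
      gcongr
    have hqθ : 0 ≤ q ^ θ := Real.rpow_nonneg hq _
    rw [add_mul]
    rcases le_or_gt q 1 with hq1 | hq1
    · have : q ≤ q ^ θ := Real.self_le_rpow_of_le_one hq hq1 hθ1.le
      have h4 : D * q ≤ D * q ^ θ := by gcongr
      have h5 : 0 ≤ |B| * q ^ θ := by positivity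
      linarith
    · have h4 : 1 ≤ q ^ θ := Real.one_le_rpow hq1.le hθ0.le
      have h5 : |B| ≤ |B| * q ^ θ := le_mul_of_one_le_right (abs_nonneg _) h4
      have h6 : 0 ≤ D * q ^ θ := by positivity
      linarith [hB x hx, le_abs_self B]

theorem injWithHolderInverse_of_bound {E F : Type*} [NormedAddCommGroup E] [NormedAddCommGroup F]
    {θ C : ℝ} (hθ : 0 < θ) {f : E → F} {S : Set E}
    (h : ∀ x ∈ S, ∀ y ∈ S, ‖x - y‖ ≤ C * ‖f x - f y‖ ^ θ) : InjWithHolderInverse θ f S := by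
  have hinj : InjOn f S := by
    intro x hx y hy hxy
    have := h x hx y hy
    rw [hxy, sub_self, norm_zero, Real.zero_rpow hθ.ne', mul_zero] at this
    exact sub_eq_zero.1 (norm_le_zero_iff.1 this)
  refine ⟨hinj, Function.invFunOn f S, hinj.leftInvOn_invFunOn, C, ?_⟩
  rintro _ ⟨x, hx, rfl⟩ _ ⟨y, hy, rfl⟩
  rw [hinj.leftInvOn_invFunOn hx, hinj.leftInvOn_invFunOn hy]
  exact h x hx y hy

theorem unitalVolume_unital_diff_goodMaps {d k : ℕ} {b : Module.Basis (Fin (k + 1)) ℝ (Herm d)}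
    (hb : b 0 = 1) {S : Set (Herm d)} (hS : IsClosed S) (hSd : S ⊆ densityOperators d)
    {H₀ : Herm d} (hH₀ : ¬ ∃ a : ℝ, H₀ = a • (1 : Herm d)) {m : ℕ}
    (hm : minkowskiDim (S - S) < (m : EReal)) {θ : ℝ} (hθ₀ : 0 < θ)
    (hθ : (θ : EReal) < 1 - minkowskiDim (S - S) / (m : EReal)) :
    unitalVolume b (unitalMaps d \ goodMaps m H₀ S θ) = 0 := by
  have : FiniteDimensional ℝ (Herm d) := b.finiteDimensional_of_finite
  have : ProperSpace (Herm d) := FiniteDimensional.proper ℝ _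
  have hScomp : IsCompact S := by
    refine Metric.isCompact_of_isClosed_isBounded hS
      ((Metric.isBounded_closedBall (x := (0 : Herm d)) (r := 1)).subset fun ρ hρ => ?_)
    rw [mem_closedBall_zero_iff]
    exact norm_le_one_of_mem_densityOperators (hSd hρ)
  have hX : IsCompact (S - S) := by
    rw [sub_eq_add_neg]
    exact hScomp.add hScomp.neg
  obtain ⟨B, hB⟩ := hX.isBounded.exists_norm_le
  have hD0 := minkowskiDim_nonneg (S - S)
  obtain ⟨D, hD⟩ : ∃ D : ℝ, minkowskiDim (S - S) = D := by
    refine ⟨(minkowskiDim (S - S)).toReal, (EReal.coe_toReal ?_ ?_).symm⟩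
    · exact (hm.trans_le le_top).ne
    · exact (lt_of_lt_of_le EReal.bot_lt_zero hD0).ne'
  rw [hD] at hm hθ hD0
  have hD0' : 0 ≤ D := EReal.coe_nonneg.1 hD0
  have hm' : D < m := by exact_mod_cast hm
  have hθ' : θ < 1 - D / m := by
    rw [← EReal.coe_coe_eq_natCast, ← EReal.coe_div] at hθ
    exact_mod_cast hθ
  have hm0 : (0 : ℝ) < m := hD0'.trans_lt hm'
  have hθ1 : θ < 1 := by
    have : 0 ≤ D / m := by positivity
    linarith
  have hDm : D < m * (1 - θ) := by
    have : D / m < 1 - θ := by linarith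
    rwa [div_lt_iff₀' hm0] at this
  obtain ⟨α, hα1, hα2⟩ := exists_between hDm
  obtain ⟨c, hc, hξ⟩ := exists_norm_le_dualCoords hb
  have htr : ∀ x ∈ S - S, expectation x 1 = 0 := by
    rintro _ ⟨x, hx, y, hy, rfl⟩
    have h1 := expectation_one_of_mem_densityOperators (hSd hx)
    have h2 := expectation_one_of_mem_densityOperators (hSd hy)
    rw [← pairing_apply] at h1 h2 ⊢
    simp [h1, h2]
  have hae := ae_holder_bound_orbit (tailCoords_ne_zero hb hH₀) hθ₀ hθ1 hα2 hB
    (LinearMap.toContinuousLinearMap (dualCoords b)) hc (fun x hx => hξ x (htr x hx))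
    (exists_cover_of_minkowskiDim_lt hX (by rw [hD]; exact_mod_cast hα1))
  refine volume_image_coords_eq_zero hae fun T hT hex => hT.2 ?_
  obtain ⟨C, hC⟩ := hex
  refine injWithHolderInverse_of_bound hθ₀ (C := C) fun x hx y hy => ?_
  have hxy : x - y ∈ S - S := sub_mem_sub hx hy
  -- Here `q` is the Euclidean distance of the two time series, which dominates each coordinate
  -- difference.
  refine hC (x - y) hxy _ (norm_nonneg _) fun i => ?_
  rw [LinearMap.coe_toContinuousLinearMap', ← tailCoords_pow_apply hb hT.1,
    ← expectation_eq_dotProduct hb (htr _ hxy), ← pairing_apply, map_sub, LinearMap.sub_apply]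
  exact PiLp.norm_apply_le (timeSeries m H₀ T x - timeSeries m H₀ T y) i

/-! ### Algebra of the complex-linear extension. -/

section Complexify

variable {d : ℕ}

theorem mat_rePart_add_imPart (X : Matrix (Fin d) (Fin d) ℂ) :
    (rePart X).mat + Complex.I • (imPart X).mat = X :=
  realPart_add_I_smul_imaginaryPart X

theorem rePart_mat_add (Y Z : Herm d) : rePart (Y.mat + Complex.I • Z.mat) = Y := by
  apply Herm.mat_injective
  change ((ℜ (Y.mat + Complex.I • Z.mat) : selfAdjoint (Matrix (Fin d) (Fin d) ℂ)) :
    Matrix (Fin d) (Fin d) ℂ) = Y.mat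
  rw [map_add, realPart_I_smul, IsSelfAdjoint.imaginaryPart (x := Z.mat) Z.2, neg_zero, add_zero,
    IsSelfAdjoint.coe_realPart (x := Y.mat) Y.2]

theorem imPart_mat_add (Y Z : Herm d) : imPart (Y.mat + Complex.I • Z.mat) = Z := by
  apply Herm.mat_injective
  change ((ℑ (Y.mat + Complex.I • Z.mat) : selfAdjoint (Matrix (Fin d) (Fin d) ℂ)) :
    Matrix (Fin d) (Fin d) ℂ) = Z.mat
  rw [map_add, imaginaryPart_I_smul, IsSelfAdjoint.imaginaryPart (x := Y.mat) Y.2, zero_add,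
    IsSelfAdjoint.coe_realPart (x := Z.mat) Z.2]

theorem complexify_add_apply (T : HermMap d) (X Y : Matrix (Fin d) (Fin d) ℂ) :
    complexify T (X + Y) = complexify T X + complexify T Y := by
  have h1 : rePart (X + Y) = rePart X + rePart Y := map_add realPart X Y
  have h2 : imPart (X + Y) = imPart X + imPart Y := map_add imaginaryPart X Y
  simp only [complexify, h1, h2, map_add, Herm.mat_add, smul_add]
  abel

theorem complexify_smul_apply (T : HermMap d) (z : ℂ) (X : Matrix (Fin d) (Fin d) ℂ) :
    complexify T (z • X) = z • complexify T X := by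
  have h1 : rePart (z • X) = z.re • rePart X + (-z.im) • imPart X := by
    rw [neg_smul, ← sub_eq_add_neg]; exact realPart_smul z X
  have h2 : imPart (z • X) = z.re • imPart X + z.im • rePart X := imaginaryPart_smul z X
  simp only [complexify, h1, h2, map_add, map_smul, Herm.mat_add, Herm.mat_smul]
  ext i j
  simp only [Matrix.add_apply, Matrix.smul_apply, smul_eq_mul, Complex.real_smul]
  apply Complex.ext <;> simp <;> ring

/-- The complex-linear extension as a linear map. -/
def complexifyLin (T : HermMap d) :
    Matrix (Fin d) (Fin d) ℂ →ₗ[ℂ] Matrix (Fin d) (Fin d) ℂ where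
  toFun := complexify T
  map_add' := complexify_add_apply T
  map_smul' := complexify_smul_apply T

theorem complexify_one (X : Matrix (Fin d) (Fin d) ℂ) : complexify 1 X = X :=
  mat_rePart_add_imPart X

theorem complexify_mul (T T' : HermMap d) (X : Matrix (Fin d) (Fin d) ℂ) :
    complexify (T * T') X = complexify T (complexify T' X) := by
  simp only [complexify, rePart_mat_add, imPart_mat_add]
  rfl

theorem complexify_add (T T' : HermMap d) (X : Matrix (Fin d) (Fin d) ℂ) :
    complexify (T + T') X = complexify T X + complexify T' X := by
  simp only [complexify, _root_.add_apply, Herm.mat_add, smul_add]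
  abel

theorem complexify_smul (a : ℝ) (T : HermMap d) (X : Matrix (Fin d) (Fin d) ℂ) :
    complexify (a • T) X = a • complexify T X := by
  simp only [complexify, _root_.smul_apply, Herm.mat_smul, smul_add,
    smul_comm Complex.I a]

theorem conjTranspose_complexify (T : HermMap d) (X : Matrix (Fin d) (Fin d) ℂ) :
    (complexify T X).conjTranspose = complexify T X.conjTranspose := by
  have hX : X.conjTranspose = (rePart X).mat + Complex.I • (-(imPart X)).mat := by
    conv_lhs => rw [← mat_rePart_add_imPart X]
    rw [Matrix.conjTranspose_add, Matrix.conjTranspose_smul, Herm.conjTranspose_mat,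
      Herm.conjTranspose_mat, ← neg_one_smul ℝ (imPart X), Herm.mat_smul]
    simp
  rw [hX]
  simp only [complexify, rePart_mat_add, imPart_mat_add]
  rw [Matrix.conjTranspose_add, Matrix.conjTranspose_smul, Herm.conjTranspose_mat,
    Herm.conjTranspose_mat, ← neg_one_smul ℝ (imPart X), map_smul, Herm.mat_smul]
  simp

theorem continuous_complexify (X : Matrix (Fin d) (Fin d) ℂ) :
    Continuous fun T : HermMap d => complexify T X := by
  have hm : Continuous (Herm.mat (d := d)) := continuous_subtype_val
  have h : ∀ Y : Herm d, Continuous fun T : HermMap d => (T Y).mat :=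
    fun Y => hm.comp (ContinuousLinearMap.apply ℝ (Herm d) Y).continuous
  exact (h _).add ((h _).const_smul Complex.I)

end Complexify

/-! ### The cone of completely positive maps, its exponentials, and Choi matrices. -/

section CompletelyPositive

variable {d : ℕ}

theorem IsCompletelyPositive.one : IsCompletelyPositive (1 : HermMap d) := by
  intro n M hM
  have : M.map (complexify 1) = M :=
    Matrix.ext fun i j => complexify_one _
  rwa [this]

theorem IsCompletelyPositive.mul {T T' : HermMap d} (hT : IsCompletelyPositive T)
    (hT' : IsCompletelyPositive T') : IsCompletelyPositive (T * T') := by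
  intro n M hM
  have : M.map (complexify (T * T')) = (M.map (complexify T')).map (complexify T) :=
    Matrix.ext fun i j => complexify_mul _ _ _
  rw [this]
  exact hT n _ (hT' n M hM)

theorem IsCompletelyPositive.add {T T' : HermMap d} (hT : IsCompletelyPositive T)
    (hT' : IsCompletelyPositive T') : IsCompletelyPositive (T + T') := by
  intro n M hM
  have : M.map (complexify (T + T')) = M.map (complexify T) + M.map (complexify T') :=
    Matrix.ext fun i j => complexify_add _ _ _
  rw [this]
  exact (hT n M hM).add (hT' n M hM)

theorem IsCompletelyPositive.smul {T : HermMap d} (hT : IsCompletelyPositive T) {a : ℝ}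
    (ha : 0 ≤ a) : IsCompletelyPositive (a • T) := by
  intro n M hM
  have : M.map (complexify (a • T)) = a • M.map (complexify T) :=
    Matrix.ext fun i j => complexify_smul _ _ _
  rw [this]
  exact (hT n M hM).smul ha

theorem IsCompletelyPositive.zero : IsCompletelyPositive (0 : HermMap d) := by
  simpa using IsCompletelyPositive.one.smul (d := d) le_rfl

theorem IsCompletelyPositive.pow {T : HermMap d} (hT : IsCompletelyPositive T) (n : ℕ) :
    IsCompletelyPositive (T ^ n) := by
  induction n with
  | zero => simpa using IsCompletelyPositive.one
  | succ n ih => rw [pow_succ]; exact ih.mul hT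

theorem isClosed_posSemidef {n : Type*} [Fintype n] :
    IsClosed {A : Matrix n n ℂ | A.PosSemidef} := by
  simp only [Matrix.posSemidef_iff_dotProduct_mulVec, ofPred_and, ofPred_forall]
  refine IsClosed.inter (isClosed_eq continuous_id.matrix_conjTranspose continuous_id)
    (isClosed_iInter fun x => isClosed_le continuous_const ?_)
  exact continuous_const.dotProduct (continuous_id.matrix_mulVec continuous_const)

theorem isClosed_isCompletelyPositive : IsClosed {T : HermMap d | IsCompletelyPositive T} := by
  simp only [IsCompletelyPositive, ofPred_forall]
  refine isClosed_iInter fun n => isClosed_iInter fun M => isClosed_iInter fun _ => ?_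
  refine isClosed_posSemidef.preimage (f := fun T : HermMap d =>
    Matrix.comp (Fin n) (Fin n) (Fin d) (Fin d) ℂ (M.map (complexify T))) ?_
  refine continuous_matrix fun a b => ?_
  have := (continuous_complexify (M a.1 b.1)).matrix_elem a.2 b.2
  exact this

/-- The partial sums of the series lie in a closed convex cone that is stable under products. -/
theorem IsCompletelyPositive.exp [CompleteSpace (Herm d)] {T : HermMap d}
    (hT : IsCompletelyPositive T) : IsCompletelyPositive (NormedSpace.exp T) := by
  have h := NormedSpace.exp_series_hasSum_exp' (𝕂 := ℝ) T
  refine isClosed_isCompletelyPositive.mem_of_tendsto h (Eventually.of_forall fun s => ?_)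
  refine Finset.sum_induction _ IsCompletelyPositive (fun _ _ => IsCompletelyPositive.add)
    IsCompletelyPositive.zero fun n _ => (hT.pow n).smul (by positivity)

theorem exp_apply_one [CompleteSpace (Herm d)] {L : HermMap d} (hL : L 1 = 0) :
    (NormedSpace.exp L) 1 = 1 := by
  have h := (ContinuousLinearMap.apply ℝ (Herm d) (1 : Herm d)).hasSum
    (NormedSpace.exp_series_hasSum_exp' (𝕂 := ℝ) L)
  refine h.unique ?_
  have h0 : ∀ n ≠ 0, ((ContinuousLinearMap.apply ℝ (Herm d)) 1)
      (((n.factorial : ℝ))⁻¹ • L ^ n) = 0 := by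
    intro n hn
    obtain ⟨n, rfl⟩ := Nat.exists_eq_succ_of_ne_zero hn
    simp [pow_succ, hL]
  simpa using hasSum_single 0 h0

/-- `Ψ - 1` generates a semigroup of channels if `Ψ` is a channel. -/
theorem smul_sub_one_mem_lindbladGenerators [CompleteSpace (Herm d)] {Ψ : HermMap d}
    (hΨ : Ψ ∈ channels d) {t : ℝ} (ht : 0 ≤ t) : t • (Ψ - 1) ∈ lindbladGenerators d := by
  intro s hs
  have h1 : Ψ 1 = 1 := hΨ.1
  refine ⟨exp_apply_one (by simp [h1]), ?_⟩
  let : NormedAlgebra ℚ (HermMap d) := NormedAlgebra.restrictScalars ℚ ℝ _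
  -- The identity part is a commuting scalar, so the exponential is `e ^ (-s t)` times that of `(s *
  -- t) • Ψ`.
  have e : s • t • (Ψ - 1) = (s * t) • Ψ + algebraMap ℝ (HermMap d) (-(s * t)) := by
    rw [Algebra.algebraMap_eq_smul_one, smul_smul, smul_sub, neg_smul, sub_eq_add_neg]
  rw [e, NormedSpace.exp_add_of_commute (Algebra.commutes _ _).symm,
    ← NormedSpace.algebraMap_exp_comm, ← Real.exp_eq_exp_ℝ, ← Algebra.commutes, ← Algebra.smul_def]
  exact ((hΨ.2.smul (mul_nonneg hs ht)).exp).smul (Real.exp_pos _).le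

/-- The Choi matrix. -/
def choi (T : HermMap d) : Matrix (Fin d × Fin d) (Fin d × Fin d) ℂ :=
  fun a b => complexify T (Matrix.single a.1 b.1 1) a.2 b.2

theorem complexify_apply_eq_sum_choi (T : HermMap d) (X : Matrix (Fin d) (Fin d) ℂ)
    (i j : Fin d) : complexify T X i j = ∑ p, ∑ q, X p q * choi T (p, i) (q, j) := by
  have h : complexify T X = ∑ p, ∑ q, X p q • complexify T (Matrix.single p q 1) := by
    change complexifyLin T X = ∑ p, ∑ q, X p q • complexifyLin T (Matrix.single p q 1)
    conv_lhs => rw [Matrix.matrix_eq_sum_single X]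
    simp only [_root_.map_sum, ← map_smul, Matrix.smul_single, smul_eq_mul, mul_one]
  rw [h]
  simp only [Matrix.sum_apply, Matrix.smul_apply, smul_eq_mul, choi]

/-- The image block matrix is a compression of `M ⊗ choi T`: the entry formula contracts the inner
index of `M` with the first index of the Choi matrix. -/
theorem isCompletelyPositive_of_choi {T : HermMap d} (hT : (choi T).PosSemidef) :
    IsCompletelyPositive T := by
  intro n M hM
  -- The map `e` puts the same index `p` into both tensor factors, and `V` sums over `p`.
  set e : (Fin n × Fin d) × Fin d → (Fin n × Fin d) × (Fin d × Fin d) :=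
    fun a => ((a.1.1, a.2), (a.2, a.1.2)) with he
  have h1 := (hM.kronecker hT).submatrix e
  set V : Matrix ((Fin n × Fin d) × Fin d) (Fin n × Fin d) ℂ :=
    Matrix.of fun a b => if a.1 = b then 1 else 0 with hV
  have h2 := h1.conjTranspose_mul_mul_same V
  refine (congrArg Matrix.PosSemidef ?_).mpr h2
  ext a b : 2
  rw [Matrix.mul_apply]
  simp only [Matrix.mul_apply, Matrix.conjTranspose_apply, hV, Matrix.of_apply,
    Fintype.sum_prod_type (α₁ := Fin n × Fin d), Matrix.submatrix_apply, Matrix.kroneckerMap_apply]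
  have h3 : Matrix.comp (Fin n) (Fin n) (Fin d) (Fin d) ℂ (M.map (complexify T)) a b =
      complexify T (M a.1 b.1) a.2 b.2 := rfl
  rw [h3, complexify_apply_eq_sum_choi, Finset.sum_comm]
  simp only [apply_ite star, star_one, star_zero, ite_mul, one_mul, zero_mul, mul_ite, mul_one,
    mul_zero]
  rw [Finset.sum_eq_single b]
  · refine Finset.sum_congr rfl fun q _ => ?_
    simp only [if_true]
    rw [Finset.sum_eq_single a]
    · exact Finset.sum_congr rfl fun p _ => by simp [he, Matrix.comp_apply]
    · intro x _ hx
      simp [hx]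
    · simp
  · intro y _ hy
    simp [hy]
  · simp

theorem isHermitian_choi (T : HermMap d) : (choi T).IsHermitian := by
  ext a b
  have h := congrFun (congrFun (conjTranspose_complexify T (Matrix.single b.1 a.1 1)) a.2) b.2
  rw [Matrix.conjTranspose_single, star_one] at h
  exact h

/-- The perturbation contributes at most `η (∑ ‖x i‖)²` to the quadratic form, and Cauchy-Schwarz
bounds this by `η * card n * ∑ ‖x i‖²`. -/
theorem posSemidef_of_near_scalar {n : Type*} [Fintype n] [DecidableEq n] {C : Matrix n n ℂ}
    (hC : C.IsHermitian) {a η : ℝ} (hη : η * Fintype.card n ≤ a)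
    (h : ∀ i j, ‖(C - (a : ℂ) • (1 : Matrix n n ℂ)) i j‖ ≤ η) : C.PosSemidef := by
  refine Matrix.PosSemidef.of_dotProduct_mulVec_nonneg hC fun x => ?_
  have him : (star x ⬝ᵥ C.mulVec x).im = 0 := hC.im_star_dotProduct_mulVec_self x
  rw [Complex.nonneg_iff]
  refine ⟨?_, him.symm⟩
  set D := C - (a : ℂ) • (1 : Matrix n n ℂ) with hD
  have hCD : C = (a : ℂ) • (1 : Matrix n n ℂ) + D := by rw [hD]; abel
  have e1 : (star x ⬝ᵥ ((a : ℂ) • (1 : Matrix n n ℂ)).mulVec x) = ((a * ∑ i, ‖x i‖ ^ 2 : ℝ) : ℂ) := by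
    rw [Matrix.smul_mulVec, Matrix.one_mulVec, dotProduct_smul]
    simp only [dotProduct, Pi.star_apply, RCLike.star_def, Complex.conj_mul', smul_eq_mul]
    push_cast
    rfl
  rcases isEmpty_or_nonempty n with hn | ⟨⟨i₀⟩⟩
  · simp [dotProduct]
  have hη0 : 0 ≤ η := (norm_nonneg _).trans (h i₀ i₀)
  have e2 : ‖star x ⬝ᵥ D.mulVec x‖ ≤ η * (∑ i, ‖x i‖) ^ 2 := by
    calc ‖star x ⬝ᵥ D.mulVec x‖ ≤ ∑ i, ∑ j, ‖x i‖ * (η * ‖x j‖) := by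
          refine (norm_sum_le _ _).trans (Finset.sum_le_sum fun i _ => ?_)
          rw [← Finset.mul_sum, norm_mul, Pi.star_apply, norm_star]
          gcongr
          refine (norm_sum_le _ _).trans (Finset.sum_le_sum fun j _ => ?_)
          rw [norm_mul]
          gcongr
          exact h i j
      _ = η * (∑ i, ‖x i‖) ^ 2 := by
          rw [sq, Finset.sum_mul_sum, Finset.mul_sum]
          refine Finset.sum_congr rfl fun i _ => ?_
          rw [Finset.mul_sum]
          exact Finset.sum_congr rfl fun j _ => by ring
  have e3 : (∑ i, ‖x i‖) ^ 2 ≤ Fintype.card n * ∑ i, ‖x i‖ ^ 2 := sq_sum_le_card_mul_sum_sq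
  have e4 : 0 ≤ ∑ i, ‖x i‖ ^ 2 := by positivity
  rw [hCD, Matrix.add_mulVec, dotProduct_add, e1, Complex.add_re, Complex.ofReal_re]
  have e5 := (abs_le.1 (Complex.abs_re_le_norm (star x ⬝ᵥ D.mulVec x))).1
  have e6 : η * (∑ i, ‖x i‖) ^ 2 ≤ a * ∑ i, ‖x i‖ ^ 2 :=
    (mul_le_mul_of_nonneg_left e3 hη0).trans (by rw [← mul_assoc]; gcongr)
  linarith

variable (d) in
/-- The completely depolarizing channel `X ↦ tr[X] / d`. -/
def depolarizing [FiniteDimensional ℝ (Herm d)] : HermMap d :=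
  LinearMap.toContinuousLinearMap
    (((d : ℝ)⁻¹ • (pairing d).flip 1).smulRight (1 : Herm d))

theorem depolarizing_apply [FiniteDimensional ℝ (Herm d)] (X : Herm d) :
    depolarizing d X = ((d : ℝ)⁻¹ * expectation X 1) • (1 : Herm d) := rfl

theorem expectation_one (X : Herm d) : (expectation X 1 : ℂ) = X.mat.trace := by
  have h : X.mat.trace = star X.mat.trace := by
    rw [← Matrix.trace_conjTranspose, Herm.conjTranspose_mat]
  rw [expectation, Herm.mat_one, mul_one]
  exact Complex.conj_eq_iff_re.1 h.symm

theorem complexify_depolarizing [FiniteDimensional ℝ (Herm d)] (X : Matrix (Fin d) (Fin d) ℂ) :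
    complexify (depolarizing d) X = ((d : ℂ)⁻¹ * X.trace) • (1 : Matrix (Fin d) (Fin d) ℂ) := by
  conv_rhs => rw [← mat_rePart_add_imPart X]
  rw [Matrix.trace_add, Matrix.trace_smul, ← expectation_one, ← expectation_one, complexify,
    depolarizing_apply, depolarizing_apply, Herm.mat_smul, Herm.mat_smul, Herm.mat_one]
  ext i j
  simp only [Matrix.add_apply, Matrix.smul_apply, Complex.real_smul, smul_eq_mul]
  push_cast
  ring

theorem choi_depolarizing [FiniteDimensional ℝ (Herm d)] :
    choi (depolarizing d) = (((d : ℝ)⁻¹ : ℝ) : ℂ) • (1 : Matrix (Fin d × Fin d) (Fin d × Fin d) ℂ) := by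
  ext ⟨p, i⟩ ⟨q, j⟩
  simp only [choi, complexify_depolarizing, Matrix.smul_apply, smul_eq_mul, Matrix.one_apply,
    Prod.mk.injEq]
  by_cases hpq : p = q
  · subst hpq; simp
  · simp [hpq, Matrix.trace_single_eq_of_ne]

theorem eventually_isCompletelyPositive [FiniteDimensional ℝ (Herm d)] (hd : 0 < d) :
    ∀ᶠ T in 𝓝 (depolarizing d), IsCompletelyPositive T := by
  have hd' : (0 : ℝ) < d := by exact_mod_cast hd
  -- The Choi matrix of the depolarizing channel is `d⁻¹` times the identity of size `d * d`, so
  -- this is the tolerated entrywise error.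
  set η : ℝ := (d : ℝ)⁻¹ / (d * d) with hη
  have hη0 : 0 < η := by positivity
  have h : ∀ a b : Fin d × Fin d, ∀ᶠ T in 𝓝 (depolarizing d),
      ‖(choi T - (((d : ℝ)⁻¹ : ℝ) : ℂ) • (1 : Matrix (Fin d × Fin d) (Fin d × Fin d) ℂ)) a b‖ < η := by
    intro a b
    have hc : Continuous fun T : HermMap d => ‖(choi T - choi (depolarizing d)) a b‖ :=
      (((continuous_complexify (Matrix.single a.1 b.1 1)).matrix_elem a.2 b.2).sub
        continuous_const).norm
    rw [← choi_depolarizing]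
    refine hc.continuousAt.eventually (gt_mem_nhds ?_)
    simpa using hη0
  filter_upwards [eventually_all.2 fun a => eventually_all.2 (h a)] with T hT
  refine isCompletelyPositive_of_choi (posSemidef_of_near_scalar (isHermitian_choi T)
    (η := η) ?_ fun a b => (hT a b).le)
  simp only [Fintype.card_prod, Fintype.card_fin, Nat.cast_mul, hη]
  rw [div_mul_cancel₀ _ (by positivity)]

theorem depolarizing_one [FiniteDimensional ℝ (Herm d)] (hd : 0 < d) :
    depolarizing d 1 = 1 := by
  have hd' : (d : ℝ) ≠ 0 := by exact_mod_cast hd.ne'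
  have : expectation (1 : Herm d) 1 = d := by simp [expectation, Herm.mat_one]
  rw [depolarizing_apply, this, inv_mul_cancel₀ hd', one_smul]

end CompletelyPositive

/-! ### Positive measure of the Lindblad maps. -/

section PositiveMeasure

variable {d k : ℕ} (b : Module.Basis (Fin (k + 1)) ℝ (Herm d))

/-- The coordinates as a linear map. -/
def coordsLin : HermMap d →ₗ[ℝ] (Fin (k + 1) → Fin k → ℝ) where
  toFun := coords b
  map_add' T T' := by ext i j; simp [coords]
  map_smul' a T := by ext i j; simp [coords]

/-- The map with given coordinates that annihilates the first basis vector. -/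
def ofCoords [FiniteDimensional ℝ (Herm d)] : (Fin (k + 1) → Fin k → ℝ) →ₗ[ℝ] HermMap d :=
  LinearMap.toContinuousLinearMap.toLinearMap ∘ₗ (b.constr ℝ).toLinearMap ∘ₗ
    { toFun := fun M => Fin.cons 0 fun j => ∑ i, M i j • b i
      map_add' := fun M M' => by
        ext l : 1
        refine Fin.cases (by simp) (fun j => ?_) l
        simp [add_smul, Finset.sum_add_distrib]
      map_smul' := fun a M => by
        ext l : 1
        refine Fin.cases (by simp) (fun j => ?_) l
        simp [Finset.smul_sum, smul_smul] }

theorem lindbladMaps_subset_channels : lindbladMaps d ⊆ channels d := by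
  rintro _ ⟨-, L, hL, rfl⟩
  simpa using hL 1 zero_le_one

theorem unitalVolume_inter_ne_zero_and_diff_eq_zero {B G : Set (HermMap d)}
    (hB : B ⊆ unitalMaps d) (hB0 : unitalVolume b B ≠ 0)
    (hG : unitalVolume b (unitalMaps d \ G) = 0) :
    unitalVolume b (B ∩ G) ≠ 0 ∧ unitalVolume b (B \ G) = 0 := by
  have h1 : unitalVolume b (B \ G) = 0 :=
    measure_mono_null (image_mono (sdiff_subset_sdiff_left hB)) hG
  refine ⟨fun h => hB0 ?_, h1⟩
  rw [unitalVolume, ← inter_union_sdiff B G, image_union]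
  exact measure_union_null h h1

variable [FiniteDimensional ℝ (Herm d)]

theorem ofCoords_apply_zero (M : Fin (k + 1) → Fin k → ℝ) : ofCoords b M (b 0) = 0 := by
  change b.constr ℝ _ (b 0) = 0
  rw [b.constr_basis]
  rfl

theorem ofCoords_apply_succ (M : Fin (k + 1) → Fin k → ℝ) (j : Fin k) :
    ofCoords b M (b j.succ) = ∑ i, M i j • b i := by
  change b.constr ℝ _ (b j.succ) = _
  rw [b.constr_basis]
  rfl

theorem coords_ofCoords (M : Fin (k + 1) → Fin k → ℝ) : coords b (ofCoords b M) = M := by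
  ext i j
  rw [coords, ofCoords_apply_succ, b.repr_sum_self fun i => M i j]

theorem ofCoords_coords {L : HermMap d} (hL : L (b 0) = 0) : ofCoords b (coords b L) = L := by
  apply ContinuousLinearMap.coe_injective
  refine b.ext fun l => Fin.cases ?_ (fun j => ?_) l
  · exact (ofCoords_apply_zero b _).trans hL.symm
  · refine (ofCoords_apply_succ b _ j).trans ?_
    exact b.sum_repr (L (b j.succ))

theorem unitalVolume_lindbladMaps_ne_zero (hb : b 0 = 1) :
    unitalVolume b (lindbladMaps d) ≠ 0 := by
  have hcomp : CompleteSpace (Herm d) := FiniteDimensional.complete ℝ _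
  have hd : 0 < d := by
    rcases Nat.eq_zero_or_pos d with rfl | hd
    -- For `d = 0` the space is trivial, yet a basis vector is nonzero.
    · have h1 : b 0 = 0 := Herm.mat_injective (Subsingleton.elim _ _)
      exact absurd h1 (b.ne_zero 0)
    · exact hd
  have : FiniteDimensional ℝ (HermMap d) := inferInstance
  set P := LinearMap.toContinuousLinearMap (coordsLin b) with hP
  set Q := LinearMap.toContinuousLinearMap (ofCoords b) with hQ
  have hPQ : P.comp Q = ContinuousLinearMap.id ℝ _ := by
    ext1 M
    exact coords_ofCoords b M
  set f : (Fin (k + 1) → Fin k → ℝ) → (Fin (k + 1) → Fin k → ℝ) :=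
    fun M => coords b (NormedSpace.exp (ofCoords b M)) with hf
  have hfd : HasStrictFDerivAt f (ContinuousLinearMap.id ℝ (Fin (k + 1) → Fin k → ℝ)) 0 := by
    have h1 : HasStrictFDerivAt (NormedSpace.exp : HermMap d → HermMap d)
        (1 : HermMap d →L[ℝ] HermMap d) (Q 0) := by
      rw [map_zero]
      exact hasStrictFDerivAt_exp_zero
    have h2 := P.hasStrictFDerivAt.comp 0 (h1.comp 0 Q.hasStrictFDerivAt)
    have h3 : P.comp ((1 : HermMap d →L[ℝ] HermMap d).comp Q) = ContinuousLinearMap.id ℝ _ := by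
      rw [← hPQ]; rfl
    rw [h3] at h2
    exact h2
  -- Near `0`, `f` is so close to its derivative, the identity, that it shrinks volumes by at most
  -- the factor `1 / 2`; any factor below `1` would do.
  obtain ⟨δ, hδ, hδ0⟩ := ((mul_le_addHaar_image_of_lt_det
    (volume : Measure (Fin (k + 1) → Fin k → ℝ)) (ContinuousLinearMap.id ℝ _)
    (m := 1 / 2) (by
      rw [ContinuousLinearMap.det, ContinuousLinearMap.coe_id, LinearMap.det_id, abs_one,
        ENNReal.ofReal_one]
      exact_mod_cast (by norm_num : (1 / 2 : NNReal) < 1))).and self_mem_nhdsWithin).exists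
  obtain ⟨s, hs, hsf⟩ := hfd.approximates_deriv_on_nhds (c := δ) (Or.inr hδ0)
  have hcont : Continuous fun M => 1 + ofCoords b M := continuous_const.add Q.continuous
  set M₀ := coords b (depolarizing d - 1) with hM₀
  have hM₀' : 1 + ofCoords b M₀ = depolarizing d := by
    rw [hM₀, ofCoords_coords b (by simp [hb, depolarizing_one hd])]
    abel
  obtain ⟨U, hUsub, hUo, hU⟩ := eventually_nhds_iff.1 (hcont.continuousAt.eventually
    (hM₀'.symm ▸ eventually_isCompletelyPositive hd : ∀ᶠ T in 𝓝 (1 + ofCoords b M₀),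
      IsCompletelyPositive T))
  have hto : Tendsto (fun t : ℝ => t • M₀) (𝓝[>] 0) (𝓝 0) := by
    have : Tendsto (fun t : ℝ => t • M₀) (𝓝 0) (𝓝 ((0 : ℝ) • M₀)) :=
      (continuous_id.smul continuous_const).tendsto 0
    rw [zero_smul] at this
    exact this.mono_left nhdsWithin_le_nhds
  obtain ⟨t, ht, ht0⟩ := ((hto.eventually (interior_mem_nhds.2 hs)).and self_mem_nhdsWithin).exists
  have ht0' : (0 : ℝ) < t := ht0
  -- Points of `A` are coordinates of `t • (Ψ - 1)` with `Ψ` completely positive. The small `t` only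
  -- serves to bring the open set into the region where `f` is controlled.
  set A := interior s ∩ (fun N : Fin (k + 1) → Fin k → ℝ => t⁻¹ • N) ⁻¹' U with hA
  have hAo : IsOpen A := isOpen_interior.inter (hUo.preimage (by fun_prop))
  have hAne : A.Nonempty := ⟨t • M₀, ht, by
    rw [mem_preimage, inv_smul_smul₀ ht0'.ne']; exact hU⟩
  have hvol := hδ A f (hsf.mono_set (inter_subset_left.trans interior_subset))
  have hpos : volume (f '' A) ≠ 0 := by
    intro h0
    rw [h0, nonpos_iff_eq_zero, mul_eq_zero] at hvol
    rcases hvol with h | h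
    · norm_num at h
    · exact (hAo.measure_pos volume hAne).ne' h
  refine fun h0 => hpos (measure_mono_null ?_ h0)
  rintro _ ⟨N, hN, rfl⟩
  refine ⟨NormedSpace.exp (ofCoords b N), ?_, rfl⟩
  have hN0 : ofCoords b N 1 = 0 := by rw [← hb]; exact ofCoords_apply_zero b N
  refine ⟨exp_apply_one hN0, ofCoords b N, ?_, rfl⟩
  have hch : 1 + ofCoords b (t⁻¹ • N) ∈ channels d := by
    refine ⟨?_, hUsub _ hN.2⟩
    change (1 + ofCoords b (t⁻¹ • N)) 1 = 1
    simp [hN0]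
  have h := smul_sub_one_mem_lindbladGenerators hch ht0'.le
  rwa [add_sub_cancel_left, map_smul, smul_inv_smul₀ ht0'.ne'] at h

end PositiveMeasure

end QTomo

end


theorem mainTheorem2 (d : ℕ)
    (b : Module.Basis (Fin (d ^ 2 - 1 + 1)) ℝ (QTomo.Herm d)) (hb : b 0 = 1)
    (S : Set (QTomo.Herm d)) (hS : IsClosed S) (hSd : S ⊆ QTomo.densityOperators d)
    (H₀ : QTomo.Herm d) (hH₀ : ¬ ∃ a : ℝ, H₀ = a • (1 : QTomo.Herm d))
    (m : ℕ) (hm : QTomo.minkowskiDim (S - S) < (m : EReal))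
    (θ : ℝ) (hθ₀ : 0 < θ)
    (hθ : (θ : EReal) < 1 - QTomo.minkowskiDim (S - S) / (m : EReal)) :
    (QTomo.unitalVolume b (QTomo.channels d ∩ QTomo.goodMaps m H₀ S θ) ≠ 0 ∧
      QTomo.unitalVolume b (QTomo.channels d \ QTomo.goodMaps m H₀ S θ) = 0) ∧
    (QTomo.unitalVolume b (QTomo.lindbladMaps d ∩ QTomo.goodMaps m H₀ S θ) ≠ 0 ∧
      QTomo.unitalVolume b (QTomo.lindbladMaps d \ QTomo.goodMaps m H₀ S θ) = 0) := by
  have : FiniteDimensional ℝ (QTomo.Herm d) := b.finiteDimensional_of_finite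
  have hL := QTomo.unitalVolume_lindbladMaps_ne_zero b hb
  have hC : QTomo.unitalVolume b (QTomo.channels d) ≠ 0 := fun h => hL
    (MeasureTheory.measure_mono_null (Set.image_mono QTomo.lindbladMaps_subset_channels) h)
  have hG := QTomo.unitalVolume_unital_diff_goodMaps hb hS hSd hH₀ hm hθ₀ hθ
  exact ⟨QTomo.unitalVolume_inter_ne_zero_and_diff_eq_zero b (fun T hT => hT.1) hC hG,
    QTomo.unitalVolume_inter_ne_zero_and_diff_eq_zero b (fun T hT => hT.1) hL hG⟩
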